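/- Let $\Gamma=(m_{i,j})_{i,j\in I}$ be a Coxeter matrix over an arbitrary set $I$. Let $W_\Gamma$ be its Coxeter group, with generators $s_i$ and standard length $\ell$, and let $B^+_\Gamma$ be its positive Artin–Tits monoid, generated by $\mathbf s_i$ ($i\in I$) subject only to the relations $\mathbf s_i\mathbf s_j\mathbf s_i\cdots=\mathbf s_j\mathbf s_i\mathbf s_j\cdots$ ($m_{i,j}$ factors on each side) for $m_{i,j}\neq\infty$. For $w\in W_\Gamma$ let $\mathbf w\in B^+_\Gamma$ be the element represented by one (and hence any) reduced word of $w$; the elements of $\mathbf W_\Gamma=\{\mathbf w\mid w\in W_\Gamma\}$ are called simple. For $K\subseteq I$ put $\Gamma_K=(m_{i,j})_{i,j\in K}$ and $W_K=\langle s_k\mid k\in K\rangle$. Call $K$, or $\Gamma_K$, spherical if $W_K$ is finite; in that case $r_K$ denotes the unique element of maximal length in $W_K$, and $\mathbf r_K$ its lift in $\mathbf W_\Gamma$. A partition $\tilde I$ of $I$ into non-empty sets is called admissible for $\Gamma$ if every $\alpha\in\tilde I$ is spherical and, for all $w\in\langle r_\beta\mid\beta\in\tilde I\rangle$ and all $\alpha\in\tilde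 I$, either $\ell(ws_i)=\ell(w)+1$ for all $i\in\alpha$ or $\ell(ws_i)=\ell(w)-1$ for all $i\in\alpha$. Its type is the matrix of orders $(|r_\alpha r_\beta|)_{\alpha,\beta\in\tilde I}$. Let $J\subseteq I$ and let $\tilde J$ be an admissible partition of $\Gamma_J$, of type $\tilde\Gamma$. Put $\tilde W=\langle r_\alpha\mid\alpha\in\tilde J\rangle\subseteq W_\Gamma$, let $\tilde{\mathbf W}=\{\mathbf w\mid w\in\tilde W\}$, and let $\tilde B^+$ be the submonoid of $B^+_\Gamma$ generated by the $\mathbf r_\alpha$, $\alpha\in\tilde J$. Then $\tilde\Gamma$ is a Coxeter matrix, there is a monoid morphism $\varphi:B^+_{\tilde\Gamma}\to B^+_\Gamma$ with $\varphi(\mathbf s_\alpha)=\mathbf r_\alpha$ for all $\alpha\in\tilde J$, and $$\varphi(\mathbf W_{\tilde\Gamma})=\tilde B^+\cap\mathbf W_\Gamma=\tilde{\mathbf W}.$$ Moreover, $\tilde\Gamma$ is spherical if and only if $\Gamma_J$ is spherical, and in that case $\varphi(\mathbf r_{\tilde J})=\mathbf r_J$, where $\mathbf r_{\tilde J}\in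 B^+_{\tilde\Gamma}$ is the lift of the longest element of $W_{\tilde\Gamma}$. -/

import Mathlib

namespace CoxeterMatrix

/-- The standard length on the Coxeter group `W_Γ`, with respect to its simple reflections. -/
noncomputable def len {I : Type*} (M : CoxeterMatrix I) (w : M.Group) : ℕ :=
  M.toCoxeterSystem.length w

/-- The defining relations of the positive Artin-Tits monoid: for `m_{i,j} ≠ ∞` (Mathlib encodes
`∞` by `0`) the two alternating words in `i`, `j` of length `m_{i,j}` are identified. -/
inductive ArtinRel {I : Type*} (M : CoxeterMatrix I) : FreeMonoid I → FreeMonoid I → Prop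
  | braid (i j : I) (h : M i j ≠ 0) :
      ArtinRel M (FreeMonoid.ofList (CoxeterSystem.braidWord M i j))
        (FreeMonoid.ofList (CoxeterSystem.braidWord M j i))

/-- The positive Artin-Tits monoid `B⁺_Γ`. -/
abbrev ArtinMonoid {I : Type*} (M : CoxeterMatrix I) : Type _ :=
  PresentedMonoid M.ArtinRel

/-- The generator of the Artin-Tits monoid attached to the vertex `i`. -/
def artinGen {I : Type*} (M : CoxeterMatrix I) (i : I) : M.ArtinMonoid :=
  PresentedMonoid.of M.ArtinRel i

/-- The element of the Artin-Tits monoid represented by a word on `I`. -/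
def artinWord {I : Type*} (M : CoxeterMatrix I) (ω : List I) : M.ArtinMonoid :=
  (ω.map M.artinGen).prod

/-- The lift of `w ∈ W_Γ` to `B⁺_Γ`: the element represented by a reduced word of `w`. By the
theorem of Tits on reduced words, the chosen reduced word does not matter. -/
noncomputable def simpleLift {I : Type*} (M : CoxeterMatrix I) (w : M.Group) : M.ArtinMonoid :=
  M.artinWord (M.toCoxeterSystem.exists_isReduced w).choose

/-- The set of simple elements of `B⁺_Γ`: all lifts of elements of `W_Γ`. -/
def simpleElements {I : Type*} (M : CoxeterMatrix I) : Set M.ArtinMonoid :=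
  Set.range M.simpleLift

/-- The standard parabolic subgroup `W_J` of `W_Γ`. -/
def parabolic {I : Type*} (M : CoxeterMatrix I) (J : Set I) : Subgroup M.Group :=
  Subgroup.closure (M.simple '' J)

/-- The set `J` of vertices (equivalently, the matrix `Γ_J`) is spherical: `W_J` is finite. -/
def IsSpherical {I : Type*} (M : CoxeterMatrix I) (J : Set I) : Prop :=
  (M.parabolic J : Set M.Group).Finite

/-- `r` is an element of maximal standard length in `W_J`. -/
def IsLongest {I : Type*} (M : CoxeterMatrix I) (J : Set I) (r : M.Group) : Prop :=
  r ∈ M.parabolic J ∧ ∀ w ∈ M.parabolic J, M.len w ≤ M.len r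

/-- The element `r_J` of maximal standard length in `W_J`, for spherical `J` (it is then unique;
the value for non-spherical `J` is irrelevant). -/
noncomputable def longest {I : Type*} (M : CoxeterMatrix I) (J : Set I) : M.Group :=
  Classical.epsilon (M.IsLongest J)

theorem isLongest_longest {I : Type*} (M : CoxeterMatrix I) {J : Set I} (hJ : M.IsSpherical J) :
    M.IsLongest J (M.longest J) := by
  obtain ⟨r, hr, hmax⟩ := Set.exists_max_image _ M.len hJ ⟨1, (M.parabolic J).one_mem⟩
  exact Classical.epsilon_spec (p := M.IsLongest J) ⟨r, hr, hmax⟩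

/-- The simple element of `B⁺_Γ` which is the lift of `r_J`. -/
noncomputable def artinLongest {I : Type*} (M : CoxeterMatrix I) (J : Set I) : M.ArtinMonoid :=
  M.simpleLift (M.longest J)

/-- The submatrix `Γ_J = (m_{i,j})_{i,j ∈ J}`. -/
def restrict {I : Type*} (M : CoxeterMatrix I) (J : Set I) : CoxeterMatrix J where
  M := fun i j => M i j
  isSymm := by
    ext i j
    exact M.symmetric j i
  diagonal := fun i => M.diagonal i
  off_diagonal := fun i j h => M.off_diagonal i j (fun e => h (Subtype.ext e))

/-- `I⁺(w)`, the set of right ascents of `w`. -/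
def ascents {I : Type*} (M : CoxeterMatrix I) (w : M.Group) : Set I :=
  {i | M.len (w * M.simple i) = M.len w + 1}

/-- `I⁻(w)`, the set of right descents of `w`. -/
def descents {I : Type*} (M : CoxeterMatrix I) (w : M.Group) : Set I :=
  {i | M.len (w * M.simple i) + 1 = M.len w}

/-- The subgroup of `W_Γ` generated by the `r_α`, `α ∈ P`. -/
def inducedSubgroup {I : Type*} (M : CoxeterMatrix I) (P : Set (Set I)) : Subgroup M.Group :=
  Subgroup.closure (M.longest '' P)

/-- The submonoid of `B⁺_Γ` generated by the lifts of the `r_α`, `α ∈ P`. -/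
def inducedSubmonoid {I : Type*} (M : CoxeterMatrix I) (P : Set (Set I)) :
    Submonoid M.ArtinMonoid :=
  Submonoid.closure (M.artinLongest '' P)

/-- `P` is an admissible partition of `Γ`. -/
structure IsAdmissible {I : Type*} (M : CoxeterMatrix I) (P : Set (Set I)) : Prop where
  isPartition : Setoid.IsPartition P
  isSpherical : ∀ α ∈ P, M.IsSpherical α
  ascents_or_descents : ∀ w ∈ M.inducedSubgroup P, ∀ α ∈ P,
    α ⊆ M.ascents w ∨ α ⊆ M.descents w

/-- The Coxeter matrix `N` over `P` is the type of the spherical partition `P` of `Γ`: its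
coefficients are the orders of the products `r_α r_β` in `W_Γ` (an infinite order is `0` in
Mathlib, as is the coefficient `∞`). -/
def IsType {I : Type*} (M : CoxeterMatrix I) (P : Set (Set I)) (N : CoxeterMatrix P) : Prop :=
  ∀ α β : P, N α β = orderOf (M.longest α.1 * M.longest β.1)

/-- A set of subsets of `J`, seen as a set of subsets of `I`. -/
def ambientParts {I : Type*} {J : Set I} (P : Set (Set J)) : Set (Set I) :=
  (fun α : Set J => Subtype.val '' α) '' P

end CoxeterMatrix

/-! The heart is a transfer of descents. Let `hom` be the map from the Coxeter group of the type to
`W_Γ` sending each generator to the corresponding `r_α`. If `α` is an ascent of `w`, then all of `α`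
consists of ascents of `hom w` (`isAscent_of_not_isRightDescent`), and descents transfer likewise.
Hence a reduced word of `w` becomes a product of elements `r_α` with additive lengths in `W_Γ`, and
`φ` carries the lift of `w` to the lift of `hom w` (`artinHom_simpleLift`). Injectivity of `hom`,
the equality of the three sets, the spherical criterion and the image of the longest element follow.

Transfer reduces to two members `a`, `b`. Multiply `r_a` and `r_b` alternately: by admissibility,
each step either adds the full length or meets an element for which all of `K a ∪ K b` are descents.
Such an element is the unique longest one of that parabolic subgroup, so both alternating products
reach it after the same number `k` of factors. Then `(r_a r_b)^k = 1`, so the obstruction cannot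
come before the order of `r_a r_b` (`type_dvd_of_not_isAscent`). This also yields the braid
relations needed to define `φ`. A general `w` is split as a minimal coset representative times an
element of the dihedral subgroup.

The background is standard Coxeter theory: strong exchange via a cocycle with values in `ℤ/2`, exact
orders of `s_i s_j` via the geometric representation, minimal coset representatives, and Matsumoto's
theorem. Matsumoto's theorem makes lifts well defined and identifies the Coxeter group of `Γ_J`
isometrically with `W_J`, so that everything can be done inside `W_Γ`. -/

namespace CoxeterSystem

open List

variable {B W : Type*} [Group W] {M : CoxeterMatrix B} (cs : CoxeterSystem M W)

/-! ### The reflection cocycle and the strong exchange property -/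

open scoped Classical in
/-- The permutation of `W × ℤ/2` attached to a simple reflection; it records inversions mod 2. -/
noncomputable def signedConj (i : B) : Equiv.Perm (W × ZMod 2) :=
  Function.Involutive.toPerm
    (fun p => (cs.simple i * p.1 * cs.simple i, p.2 + if p.1 = cs.simple i then 1 else 0)) (by
      rintro ⟨t, e⟩
      have h : cs.simple i * t * cs.simple i = cs.simple i ↔ t = cs.simple i := by
        rw [mul_eq_right, mul_eq_one_iff_inv_eq, inv_simple, eq_comm]
      by_cases ht : t = cs.simple i
      · subst ht
        simp [add_assoc, CharTwo.add_self_eq_zero]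
      · have h' : ¬ cs.simple i * t * cs.simple i = cs.simple i := by rwa [h]
        simp only [h', ht, if_false, add_zero, Prod.mk.injEq, and_true]
        simp [mul_assoc])

open scoped Classical in
theorem signedConj_apply (i : B) (p : W × ZMod 2) :
    cs.signedConj i p =
      (cs.simple i * p.1 * cs.simple i, p.2 + if p.1 = cs.simple i then 1 else 0) := rfl

-- The reflections met while applying the `2n` factors one by one, pulled back to the starting
-- point, are the elements `c⁻ᵏ s_j` with `c = s_i s_j` and `k < 2n`.
open scoped Classical in
theorem signedConj_mul_pow_apply (i j : B) (n : ℕ) (t : W) (e : ZMod 2) :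
    ((cs.signedConj i * cs.signedConj j) ^ n) (t, e) =
      ((cs.simple i * cs.simple j) ^ n * t * ((cs.simple i * cs.simple j) ^ n)⁻¹,
        e + ∑ k ∈ Finset.range (2 * n),
          if t = ((cs.simple i * cs.simple j) ^ k)⁻¹ * cs.simple j then 1 else 0) := by
  induction n with
  | zero => simp
  | succ n ih =>
    set c := cs.simple i * cs.simple j with hc
    have hsc : ∀ n : ℕ, cs.simple j * c ^ n = (c ^ n)⁻¹ * cs.simple j := by
      intro n
      have : cs.simple j * c ^ n * (cs.simple j)⁻¹ = c⁻¹ ^ n := by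
        rw [← conj_pow]
        congr 1
        simp [hc, mul_assoc]
      rw [← inv_pow, ← this]
      simp
    rw [pow_succ', Equiv.Perm.mul_apply, ih, Equiv.Perm.mul_apply, signedConj_apply,
      signedConj_apply]
    have hconj : ∀ a b : W, a * t * a⁻¹ = b ↔ t = a⁻¹ * b * a := by
      intro a b
      rw [mul_inv_eq_iff_eq_mul, mul_assoc, eq_inv_mul_iff_mul_eq]
    have e1 : c ^ n * t * (c ^ n)⁻¹ = cs.simple j ↔ t = (c ^ (2 * n))⁻¹ * cs.simple j := by
      rw [hconj, mul_assoc, hsc, two_mul, pow_add, mul_inv_rev, mul_assoc]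
    have e2 : cs.simple j * (c ^ n * t * (c ^ n)⁻¹) * cs.simple j = cs.simple i ↔
        t = (c ^ (2 * n + 1))⁻¹ * cs.simple j := by
      have : cs.simple j * (c ^ n * t * (c ^ n)⁻¹) * cs.simple j = cs.simple i ↔
          c ^ n * t * (c ^ n)⁻¹ = c⁻¹ * cs.simple j := by
        rw [← eq_mul_inv_iff_mul_eq, ← eq_inv_mul_iff_mul_eq, hc]
        simp [mul_assoc]
      rw [this, hconj, mul_assoc, mul_assoc, hsc, show 2 * n + 1 = n + (1 + n) by ring, pow_add c n,
        pow_add]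
      simp [mul_assoc]
    rw [mul_add, mul_one, Finset.sum_range_succ, Finset.sum_range_succ]
    simp only [e1, e2, Prod.mk.injEq]
    constructor
    · simp [hc, pow_succ', mul_assoc]
    · ring

/-- With `c ^ m = 1`, the sum over `k < 2m` consists of two equal halves, which cancel mod 2. -/
theorem isLiftable_signedConj : M.IsLiftable cs.signedConj := by
  classical
  intro i j
  ext1 ⟨t, e⟩
  rw [signedConj_mul_pow_apply, simple_mul_simple_pow, two_mul, Finset.sum_range_add]
  simp [pow_add, simple_mul_simple_pow, CharTwo.add_self_eq_zero]

/-- The action of `W` on `W × ℤ/2` extending `signedConj`. -/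
noncomputable def signedConjHom : W →* Equiv.Perm (W × ZMod 2) :=
  cs.lift ⟨cs.signedConj, cs.isLiftable_signedConj⟩

/-- The reflection cocycle: for a reflection `t` it is `1` exactly if `t` is a right inversion. -/
noncomputable def invCocycle (w t : W) : ZMod 2 := (cs.signedConjHom w (t, 0)).2

theorem signedConjHom_apply (w t : W) (e : ZMod 2) :
    cs.signedConjHom w (t, e) = (w * t * w⁻¹, e + cs.invCocycle w t) := by
  induction w using cs.simple_induction_left generalizing t e with
  | one => simp [invCocycle]
  | mul_simple_left w i ih =>
    classical
    have h : ∀ e, cs.signedConjHom (cs.simple i * w) (t, e) =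
        cs.signedConj i (w * t * w⁻¹, e + cs.invCocycle w t) := by
      intro e
      rw [map_mul, Equiv.Perm.mul_apply, ih, signedConjHom, lift_apply_simple]
    rw [invCocycle, h, h, signedConj_apply, signedConj_apply]
    simp [mul_assoc, add_assoc]

open scoped Classical in
theorem invCocycle_simple (i : B) (t : W) :
    cs.invCocycle (cs.simple i) t = if t = cs.simple i then 1 else 0 := by
  simp [invCocycle, signedConjHom, signedConj_apply]

theorem invCocycle_one (t : W) : cs.invCocycle 1 t = 0 := by simp [invCocycle]

theorem invCocycle_mul (v w t : W) :
    cs.invCocycle (v * w) t = cs.invCocycle w t + cs.invCocycle v (w * t * w⁻¹) := by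
  have h := cs.signedConjHom_apply (v * w) t 0
  rw [map_mul, Equiv.Perm.mul_apply, signedConjHom_apply, signedConjHom_apply] at h
  simpa using (congrArg Prod.snd h).symm

open scoped Classical in
theorem invCocycle_wordProd (ω : List B) (t : W) :
    cs.invCocycle (cs.wordProd ω) t = (cs.rightInvSeq ω).count t := by
  induction ω with
  | nil => simp [invCocycle_one]
  | cons i ω ih =>
    rw [wordProd_cons, invCocycle_mul, ih, invCocycle_simple, rightInvSeq, count_cons]
    push_cast
    congr 1
    have : cs.wordProd ω * t * (cs.wordProd ω)⁻¹ = cs.simple i ↔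
        (cs.wordProd ω)⁻¹ * cs.simple i * cs.wordProd ω = t := by
      rw [mul_inv_eq_iff_eq_mul, mul_assoc, inv_mul_eq_iff_eq_mul, eq_comm]
    simp [this]

/-- For `t = u s u⁻¹`, the contributions of `u` and `u⁻¹` are those in the expansion of `u u⁻¹ = 1`,
so they cancel; the middle letter `s` contributes the `1`. -/
theorem invCocycle_self {t : W} (ht : cs.IsReflection t) : cs.invCocycle t t = 1 := by
  obtain ⟨u, i, ht⟩ := ht
  have h := cs.invCocycle_mul u u⁻¹ t
  have h' := cs.invCocycle_mul u (cs.simple i * u⁻¹) t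
  have e : u⁻¹ * t * u⁻¹⁻¹ = cs.simple i := by rw [ht]; group
  have e' : cs.simple i * u⁻¹ * t * (cs.simple i * u⁻¹)⁻¹ = cs.simple i := by rw [ht]; group
  rw [mul_inv_cancel, invCocycle_one, e] at h
  rw [← mul_assoc, ← ht, invCocycle_mul, e', e, invCocycle_simple, if_pos rfl] at h'
  linear_combination h' - h

theorem invCocycle_eq_one_iff {w t : W} (ht : cs.IsReflection t) :
    cs.invCocycle w t = 1 ↔ cs.length (w * t) < cs.length w := by
  classical
  have key : ∀ w, cs.invCocycle w t = 1 → cs.length (w * t) < cs.length w := by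
    intro w h
    obtain ⟨ω, hω, rfl⟩ := cs.exists_isReduced w
    rw [invCocycle_wordProd] at h
    refine (cs.isRightInversion_of_mem_rightInvSeq hω ?_).2
    by_contra hmem
    rw [count_eq_zero_of_not_mem hmem] at h
    simp at h
  refine ⟨key w, fun h => ?_⟩
  by_contra hne
  have h0 : cs.invCocycle w t = 0 := by
    generalize cs.invCocycle w t = x at hne
    revert x
    decide
  -- Replacing `w` by `w t` flips the cocycle, so the implication already proved applies to `w t`.
  have h1 := key (w * t) (by
    rw [invCocycle_mul, cs.invCocycle_self ht, ht.mul_self]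
    simp [h0, ht.inv])
  rw [mul_assoc, ht.mul_self, mul_one] at h1
  omega

/-- The strong exchange property. -/
theorem exists_wordProd_eraseIdx {ω : List B} {t : W} (ht : cs.IsReflection t)
    (h : cs.length (cs.wordProd ω * t) < cs.length (cs.wordProd ω)) :
    t ∈ cs.rightInvSeq ω ∧
      ∃ j < ω.length, cs.wordProd ω * t = cs.wordProd (ω.eraseIdx j) := by
  classical
  rw [← cs.invCocycle_eq_one_iff ht, invCocycle_wordProd] at h
  have hmem : t ∈ cs.rightInvSeq ω := by
    by_contra hmem
    rw [count_eq_zero_of_not_mem hmem] at h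
    simp at h
  refine ⟨hmem, ?_⟩
  obtain ⟨j, hj, hjt⟩ := mem_iff_getElem.mp hmem
  refine ⟨j, by simpa using hj, ?_⟩
  rw [← wordProd_mul_getD_rightInvSeq, getD_eq_getElem _ _ hj, hjt]

/-- The exchange property for a product `x * y`. -/
theorem length_mul_conj_lt {x y : W} {i : B} (hy : cs.length y < cs.length (y * cs.simple i))
    (hxy : cs.length (x * y * cs.simple i) < cs.length (x * y)) :
    cs.length (x * (y * cs.simple i * y⁻¹)) < cs.length x := by
  have hr := (cs.isReflection_simple i)
  rw [← cs.invCocycle_eq_one_iff (hr.conj y)]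
  rw [← cs.invCocycle_eq_one_iff hr, invCocycle_mul] at hxy
  have : cs.invCocycle y (cs.simple i) = 0 := by
    have h1 : ¬ cs.invCocycle y (cs.simple i) = 1 := by
      rw [cs.invCocycle_eq_one_iff hr]; omega
    generalize cs.invCocycle y (cs.simple i) = z at h1
    revert z
    decide
  rwa [this, zero_add] at hxy

end CoxeterSystem

namespace CoxeterMatrix

open Real Module Polynomial.Chebyshev

/-! ### The geometric representation and the orders of the products of two generators -/

variable {I : Type*} (M : CoxeterMatrix I)

/-- The coefficients of twice the canonical bilinear form. -/
noncomputable def formCoeff (i j : I) : ℝ := if M i j = 0 then -2 else -(2 * cos (π / M i j))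

theorem formCoeff_self (i : I) : M.formCoeff i i = 2 := by simp [formCoeff]

theorem formCoeff_comm (i j : I) : M.formCoeff i j = M.formCoeff j i := by
  simp [formCoeff, M.symmetric i j]

theorem formCoeff_mul_sub_two {i j : I} (h : M i j ≠ 0) :
    M.formCoeff i j * M.formCoeff j i - 2 = 2 * cos (2 * (π / M i j)) := by
  rw [← M.formCoeff_comm i j, formCoeff, if_neg h, cos_two_mul]
  ring

/-- The simple coroot. -/
noncomputable def coroot (i : I) : Dual ℝ (I →₀ ℝ) :=
  Finsupp.linearCombination ℝ (fun j => M.formCoeff i j)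

/-- The simple root. -/
noncomputable def root (i : I) : I →₀ ℝ := Finsupp.single i 1

theorem root_apply_self (i : I) : (root i : I →₀ ℝ) i = 1 := Finsupp.single_eq_same

theorem root_apply_of_ne {i j : I} (h : i ≠ j) : (root i : I →₀ ℝ) j = 0 :=
  Finsupp.single_eq_of_ne h.symm

theorem coroot_root (i j : I) : M.coroot i (root j) = M.formCoeff i j := by
  simp [coroot, root, Finsupp.linearCombination_single]

theorem coroot_root_self (i : I) : M.coroot i (root i) = 2 := by
  rw [coroot_root, formCoeff_self]

/-- The simple reflection in the geometric representation. -/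
noncomputable def geomReflection (i : I) : (I →₀ ℝ) ≃ₗ[ℝ] (I →₀ ℝ) :=
  Module.reflection (M.coroot_root_self i)

theorem sin_two_pi_div_ne_zero {m : ℕ} (hm : 3 ≤ m) : sin (2 * (π / m)) ≠ 0 := by
  have hm' : (3 : ℝ) ≤ m := by exact_mod_cast hm
  have h1 : 0 < π / m := div_pos pi_pos (by linarith)
  have h2 : π / m ≤ π / 3 := div_le_div_of_nonneg_left pi_pos.le (by norm_num) hm'
  exact (sin_pos_of_pos_of_lt_pi (by linarith) (by linarith [pi_pos])).ne'

theorem two_le_of_ne {i j : I} (hij : i ≠ j) (h0 : M i j ≠ 0) : 2 ≤ M i j := by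
  have := M.off_diagonal i j hij
  change M i j ≠ 1 at this
  omega

/-- Powers of a product of two reflections are Chebyshev polynomials `S` in `2 cos (2π/m)`, that is,
quotients of sines, and the relevant ones vanish at exponent `m`. The case `m = 2` is separate,
since there the denominator `sin (2π/m)` is zero. -/
theorem isLiftable_geomReflection : M.IsLiftable M.geomReflection := by
  intro i j
  by_cases hij : i = j
  · subst hij
    rw [M.diagonal, pow_one]
    ext1 v
    exact Module.involutive_reflection (M.coroot_root_self i) v
  by_cases h0 : M i j = 0
  · rw [h0, pow_zero]
  have h2 := M.two_le_of_ne hij h0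
  obtain h2 | h3 := h2.eq_or_lt
  · have hc : M.formCoeff i j = 0 := by simp [formCoeff, ← h2]
    have hc' : M.formCoeff j i = 0 := by rw [formCoeff_comm, hc]
    rw [← h2, pow_two]
    ext1 v
    simp only [geomReflection, LinearEquiv.mul_apply, Module.reflection_apply, map_sub, map_smul,
      coroot_root, hc, hc', formCoeff_self, LinearEquiv.coe_one, id]
    module
  · have hs := sin_two_pi_div_ne_zero h3
    have hS : ∀ n : ℤ, (S ℝ n).eval (2 * cos (2 * (π / M i j))) =
        sin ((n + 1) * (2 * (π / M i j))) / sin (2 * (π / M i j)) := by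
      intro n
      rw [eq_div_iff hs, S_two_mul_real_cos]
    have hm0 : (M i j : ℝ) ≠ 0 := by exact_mod_cast h0
    ext1 v
    have key := Module.reflection_mul_reflection_pow_apply (M.coroot_root_self i)
      (M.coroot_root_self j) (M i j) v (2 * cos (2 * (π / M i j)))
      (by rw [coroot_root, coroot_root, M.formCoeff_mul_sub_two h0])
    refine key.trans ?_
    obtain ⟨k, hk | hk⟩ := Nat.even_or_odd' (M i j)
    · have e1 : ((M i j : ℤ) - 2) / 2 = k - 1 := by omega
      have e2 : ((M i j : ℤ) - 1) / 2 = k - 1 := by omega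
      have : (S ℝ (k - 1)).eval (2 * cos (2 * (π / M i j))) = 0 := by
        rw [hS]
        have : (((k - 1 : ℤ) : ℝ) + 1) * (2 * (π / M i j)) = π := by
          rw [hk] at hm0 ⊢
          push_cast at hm0 ⊢
          have hk0 : (k : ℝ) ≠ 0 := right_ne_zero_of_mul hm0
          field_simp
          ring
        rw [this, sin_pi, zero_div]
      rw [e1, e2, this]
      simp
    · have e1 : ((M i j : ℤ) - 2) / 2 = k - 1 := by omega
      have e2 : ((M i j : ℤ) - 1) / 2 = k := by omega
      have e3 : ((M i j : ℤ) - 3) / 2 = k - 1 := by omega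
      have e4 : (M i j : ℤ) / 2 = k := by omega
      have : (S ℝ k).eval (2 * cos (2 * (π / M i j))) +
          (S ℝ (k - 1)).eval (2 * cos (2 * (π / M i j))) = 0 := by
        rw [hS, hS, ← add_div]
        have : (((k : ℤ) : ℝ) + 1) * (2 * (π / M i j)) =
            2 * π - (((k - 1 : ℤ) : ℝ) + 1) * (2 * (π / M i j)) := by
          rw [hk] at hm0 ⊢
          push_cast at hm0 ⊢
          field_simp
          ring
        rw [this, sin_two_pi_sub]
        simp
      rw [e1, e2, e3, e4, this]
      simp

/-- The geometric representation. -/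
noncomputable def geomRep : M.Group →* ((I →₀ ℝ) ≃ₗ[ℝ] (I →₀ ℝ)) :=
  M.toCoxeterSystem.lift ⟨M.geomReflection, M.isLiftable_geomReflection⟩

/-- The reflection of index `i` negates the `i`-th coordinate of the root `i`; any other simple
reflection leaves that coordinate unchanged. -/
theorem simple_injective : Function.Injective M.toCoxeterSystem.simple := by
  intro i j h
  by_contra hij
  have h1 := congrArg M.geomRep h
  rw [geomRep, CoxeterSystem.lift_apply_simple, CoxeterSystem.lift_apply_simple] at h1
  have h2 := congrArg (fun v : I →₀ ℝ => v i) (LinearEquiv.congr_fun h1 (root i))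
  simp only [geomReflection, Module.reflection_apply, coroot_root, formCoeff_self] at h2
  simp [root_apply_self, root_apply_of_ne (Ne.symm hij)] at h2

/-- The coordinates of the image of the root `i` under the `k`-th power detect `k`. For `m = ∞` the
`i`-th coordinate is `2k + 1`. For finite `m ≥ 3` they force `sin (2πk/m) = 0` and `cos (2πk/m) =
1`. -/
theorem dvd_of_simple_mul_simple_pow_eq_one {i j : I} {k : ℕ}
    (h : (M.toCoxeterSystem.simple i * M.toCoxeterSystem.simple j) ^ k = 1) : M i j ∣ k := by
  by_cases hij : i = j
  · subst hij
    simp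
  have h1 := congrArg M.geomRep h
  rw [map_pow, map_mul, geomRep, CoxeterSystem.lift_apply_simple, CoxeterSystem.lift_apply_simple,
    map_one] at h1
  have h2 : ((M.geomReflection i * M.geomReflection j) ^ k) (root i) = root i := by rw [h1]; rfl
  by_cases h0 : M i j = 0
  · have key := Module.reflection_mul_reflection_pow_apply_self (M.coroot_root_self i)
      (M.coroot_root_self j) k 2 (by
        rw [coroot_root, coroot_root, ← M.formCoeff_comm i j, formCoeff, if_pos h0]; norm_num)
    have h3 := congrArg (fun v : I →₀ ℝ => v i) (key.symm.trans h2)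
    simp only [Finsupp.add_apply, Finsupp.smul_apply, root_apply_self,
      root_apply_of_ne (Ne.symm hij), smul_eq_mul, mul_one, mul_zero, add_zero] at h3
    rw [S_eval_two, S_eval_two] at h3
    push_cast at h3
    have : (k : ℝ) = 0 := by linarith
    rw [Nat.cast_eq_zero.mp this]
    exact dvd_zero _
  obtain h2' | h3 := (M.two_le_of_ne hij h0).eq_or_lt
  · rw [← h2']
    by_contra hodd
    obtain ⟨n, rfl⟩ := Nat.odd_iff.mpr (Nat.two_dvd_ne_zero.mp hodd)
    rw [pow_succ, pow_mul] at h
    have := M.toCoxeterSystem.simple_mul_simple_pow i j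
    rw [← h2'] at this
    rw [this, one_pow, one_mul, mul_eq_one_iff_eq_inv, CoxeterSystem.inv_simple] at h
    exact hij (M.simple_injective h)
  · have key := Module.reflection_mul_reflection_pow_apply_self (M.coroot_root_self i)
      (M.coroot_root_self j) k (2 * cos (2 * (π / M i j)))
      (by rw [coroot_root, coroot_root, M.formCoeff_mul_sub_two h0])
    have hs := sin_two_pi_div_ne_zero h3
    have hS : ∀ n : ℤ, (S ℝ n).eval (2 * cos (2 * (π / M i j))) =
        sin ((n + 1) * (2 * (π / M i j))) / sin (2 * (π / M i j)) := by
      intro n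
      rw [eq_div_iff hs, S_two_mul_real_cos]
    have hm3 : (3 : ℝ) ≤ M i j := by exact_mod_cast h3
    have hcos : cos (π / M i j) ≠ 0 := by
      have e1 : 0 < π / M i j := div_pos pi_pos (by linarith)
      have e2 : π / M i j ≤ π / 3 := div_le_div_of_nonneg_left pi_pos.le (by norm_num) hm3
      exact (cos_pos_of_mem_Ioo ⟨by linarith, by linarith [pi_pos]⟩).ne'
    have hi := congrArg (fun v : I →₀ ℝ => v i) (key.symm.trans h2)
    have hj := congrArg (fun v : I →₀ ℝ => v j) (key.symm.trans h2)
    simp only [Finsupp.add_apply, Finsupp.smul_apply, root_apply_self, root_apply_of_ne hij,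
      root_apply_of_ne (Ne.symm hij), smul_eq_mul, mul_one, mul_zero, add_zero, zero_add] at hi hj
    have hS1 : (S ℝ (k - 1)).eval (2 * cos (2 * (π / M i j))) = 0 := by
      have e : M.coroot j (root i) = -(2 * cos (π / M i j)) := by
        rw [coroot_root, M.formCoeff_comm j i, formCoeff, if_neg h0]
      have hne : (2 * cos (π / M i j)) ≠ 0 := mul_ne_zero two_ne_zero hcos
      rw [e, neg_neg] at hj
      exact (mul_eq_zero.mp hj).resolve_right hne
    rw [hS1, add_zero, hS, div_eq_one_iff_eq hs] at hi
    rw [hS, div_eq_zero_iff] at hS1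
    have hS2 := hS1.resolve_right hs
    push_cast at hS2 hi
    rw [sub_add_cancel] at hS2
    rw [add_mul, one_mul, sin_add, hS2, zero_mul, zero_add] at hi
    have hc1 : cos (k * (2 * (π / M i j))) = 1 := mul_right_cancel₀ hs (by rw [hi, one_mul])
    obtain ⟨n, hn⟩ := (cos_eq_one_iff _).mp hc1
    have : (n * M i j : ℝ) = k := by
      have := pi_pos.ne'
      have hm0 : (M i j : ℝ) ≠ 0 := by linarith
      field_simp at hn
      linarith
    have : (n * M i j : ℤ) = k := by exact_mod_cast this
    exact Int.natCast_dvd_natCast.mp ⟨n, by rw [← this, mul_comm]⟩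

end CoxeterMatrix

namespace CoxeterSystem

variable {B W : Type*} [Group W] {M : CoxeterMatrix B} (cs : CoxeterSystem M W)

/-! ### Standard parabolic subgroups -/

/-- The standard parabolic subgroup of a Coxeter system attached to a set of vertices. -/
def parabolic (K : Set B) : Subgroup W := Subgroup.closure (cs.simple '' K)

variable {cs} {K : Set B}

theorem simple_mem_parabolic {i : B} (hi : i ∈ K) : cs.simple i ∈ cs.parabolic K :=
  Subgroup.subset_closure ⟨i, hi, rfl⟩

theorem wordProd_mem_parabolic {ω : List B} (hω : ∀ i ∈ ω, i ∈ K) :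
    cs.wordProd ω ∈ cs.parabolic K := by
  induction ω with
  | nil => simp [one_mem]
  | cons i ω ih =>
    rw [wordProd_cons]
    exact mul_mem (simple_mem_parabolic (hω i (by simp))) (ih fun j hj => hω j (by simp [hj]))

theorem parabolic_mono {K L : Set B} (h : K ⊆ L) : cs.parabolic K ≤ cs.parabolic L :=
  Subgroup.closure_mono (Set.image_mono h)

/-- Induction on the elements of a parabolic subgroup by right multiplication. -/
@[elab_as_elim]
theorem parabolic_induction {p : (v : W) → v ∈ cs.parabolic K → Prop} (one : p 1 (one_mem _))
    (mul : ∀ v (hv : v ∈ cs.parabolic K), ∀ i (hi : i ∈ K), p v hv →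
      p (v * cs.simple i) (mul_mem hv (simple_mem_parabolic hi)))
    {v : W} (hv : v ∈ cs.parabolic K) : p v hv := by
  refine Subgroup.closure_induction_right one ?_ ?_ hv
  · rintro x hx _ ⟨i, hi, rfl⟩ h
    exact mul x hx i hi h
  · rintro x hx _ ⟨i, hi, rfl⟩ h
    simp only [inv_simple]
    exact mul x hx i hi h

theorem isReduced_append_singleton {ω : List B} (hω : cs.IsReduced ω) {i : B}
    (h : ¬ cs.IsRightDescent (cs.wordProd ω) i) : cs.IsReduced (ω ++ [i]) := by
  rw [not_isRightDescent_iff] at h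
  rw [IsReduced, wordProd_append, wordProd_singleton, h, hω.eq]
  simp

theorem IsReduced.of_append_left {ω ω' : List B} (h : cs.IsReduced (ω ++ ω')) :
    cs.IsReduced ω := by
  simpa using h.take ω.length

theorem IsReduced.length_wordProd_append_singleton {ω : List B} {i : B}
    (h : cs.IsReduced (ω ++ [i])) :
    cs.length (cs.wordProd ω * cs.simple i) = cs.length (cs.wordProd ω) + 1 := by
  have h' := h.of_append_left.eq
  have := h.eq
  rw [wordProd_append, wordProd_singleton] at this
  rw [this, h']
  simp

/-- An element of a parabolic subgroup has a reduced word with letters in the parabolic type. -/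
theorem exists_isReduced_of_mem_parabolic {v : W} (hv : v ∈ cs.parabolic K) :
    ∃ ω : List B, (∀ i ∈ ω, i ∈ K) ∧ cs.IsReduced ω ∧ cs.wordProd ω = v := by
  induction hv using parabolic_induction with
  | one => exact ⟨[], by simp, by simp [IsReduced], by simp⟩
  | mul v hv i hi ih =>
    obtain ⟨ω, hK, hω, rfl⟩ := ih
    by_cases h : cs.IsRightDescent (cs.wordProd ω) i
    · obtain ⟨-, j, hj, e⟩ := cs.exists_wordProd_eraseIdx (cs.isReflection_simple i) h
      refine ⟨ω.eraseIdx j, fun k hk => hK k (List.mem_of_mem_eraseIdx hk), ?_, e.symm⟩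
      rw [isRightDescent_iff, hω.eq] at h
      rw [IsReduced, ← e]
      have := List.length_eraseIdx_add_one hj
      omega
    · refine ⟨ω ++ [i], ?_, isReduced_append_singleton hω h, by simp [wordProd_append]⟩
      intro k hk
      rcases List.mem_append.mp hk with hk | hk
      · exact hK k hk
      · rwa [List.mem_singleton.mp hk]

theorem exists_rightDescent_of_mem_parabolic {v : W} (hv : v ∈ cs.parabolic K) (h1 : v ≠ 1) :
    ∃ i ∈ K, cs.IsRightDescent v i := by
  obtain ⟨ω, hK, hω, rfl⟩ := exists_isReduced_of_mem_parabolic hv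
  rcases List.eq_nil_or_concat ω with rfl | ⟨ω', i, rfl⟩
  · simp at h1
  · rw [List.concat_eq_append] at *
    refine ⟨i, hK i (by simp), ?_⟩
    have := hω.length_wordProd_append_singleton
    rw [IsRightDescent, wordProd_append, wordProd_singleton, simple_mul_simple_cancel_right]
    omega

/-- Lengths are additive on a coset of a parabolic subgroup, from an element of minimal length. -/
theorem length_mul_of_minimal {x : W}
    (hx : ∀ v ∈ cs.parabolic K, cs.length x ≤ cs.length (x * v)) {v : W}
    (hv : v ∈ cs.parabolic K) : cs.length (x * v) = cs.length x + cs.length v := by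
  have key : ∀ v ∈ cs.parabolic K, ∀ i ∈ K, cs.length v < cs.length (v * cs.simple i) →
      cs.length (x * v * cs.simple i) = cs.length (x * v) + 1 := by
    intro v hv i hi h
    rw [← not_isRightDescent_iff]
    intro hd
    -- A descent here would make `x * (v s v⁻¹)` shorter than `x` within the same coset.
    have := cs.length_mul_conj_lt h hd
    exact absurd (hx _ (mul_mem (mul_mem hv (simple_mem_parabolic hi)) (inv_mem hv))) (by omega)
  induction hv using parabolic_induction with
  | one => simp
  | mul v hv i hi ih =>
    rw [← mul_assoc]
    rcases cs.length_mul_simple v i with h | h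
    · rw [key v hv i hi (by omega), h, ih, add_assoc]
    · have := key (v * cs.simple i) (mul_mem hv (simple_mem_parabolic hi)) i hi
        (by rw [simple_mul_simple_cancel_right]; omega)
      rw [← mul_assoc, simple_mul_simple_cancel_right] at this
      omega

/-- Every element is the product of an element without right descents in `K` and of an element
of the parabolic subgroup of type `K`, with additive lengths. -/
theorem exists_minimal_mul (K : Set B) (w : W) :
    ∃ x, ∃ v ∈ cs.parabolic K, w = x * v ∧
      (∀ v ∈ cs.parabolic K, cs.length (x * v) = cs.length x + cs.length v) := by
  classical
  have hex : ∃ n, ∃ v ∈ cs.parabolic K, cs.length (w * v) = n := ⟨_, 1, one_mem _, rfl⟩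
  obtain ⟨v, hv, hn⟩ := Nat.find_spec hex
  refine ⟨w * v, v⁻¹, inv_mem hv, by simp, fun u hu => length_mul_of_minimal ?_ hu⟩
  intro u hu
  rw [hn, mul_assoc]
  exact Nat.find_min' hex ⟨_, mul_mem hv hu, rfl⟩

/-- Local minimality implies global minimality: if `w = x u` with `x` minimal in the coset, a
descent of `u ≠ 1` in `K` would be one of `w`. -/
theorem length_mul_of_not_isRightDescent {w : W} (hw : ∀ i ∈ K, ¬ cs.IsRightDescent w i) {v : W}
    (hv : v ∈ cs.parabolic K) : cs.length (w * v) = cs.length w + cs.length v := by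
  obtain ⟨x, u, hu, rfl, hadd⟩ := exists_minimal_mul (cs := cs) K w
  have : u = 1 := by
    by_contra h1
    obtain ⟨i, hi, hd⟩ := exists_rightDescent_of_mem_parabolic hu h1
    refine hw i hi ?_
    rw [IsRightDescent] at hd ⊢
    rw [mul_assoc, hadd _ hu, hadd _ (mul_mem hu (simple_mem_parabolic hi))]
    omega
  subst this
  rw [mul_one]
  exact hadd v hv

/-- If all elements of `K` are right descents of `w`, then every element of the parabolic
subgroup of type `K` is a suffix of `w`. -/
theorem length_mul_inv_add_of_isRightDescent {w : W} (hw : ∀ i ∈ K, cs.IsRightDescent w i)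
    {v : W} (hv : v ∈ cs.parabolic K) : cs.length (w * v⁻¹) + cs.length v = cs.length w := by
  obtain ⟨ω, hK, hω, rfl⟩ := exists_isReduced_of_mem_parabolic hv
  clear hv
  induction ω using List.reverseRecOn with
  | nil => simp
  | append_singleton ω i ih =>
    have hi : i ∈ K := hK i (by simp)
    specialize ih (fun j hj => hK j (by simp [hj])) hω.of_append_left
    have h1 := hω.length_wordProd_append_singleton
    rw [wordProd_append, wordProd_singleton]
    set u := cs.wordProd ω
    -- Exchange shortens `w u⁻¹` to `w (u s)⁻¹`; the triangle inequality shows that the drop is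
    -- exactly one.
    have h2 := cs.length_mul_conj_lt (x := w * u⁻¹) (y := u) (i := i) (by omega) (by
      rw [inv_mul_cancel_right]; exact hw i hi)
    have e : w * u⁻¹ * (u * cs.simple i * u⁻¹) = w * (u * cs.simple i)⁻¹ := by
      simp [mul_assoc]
    rw [e] at h2
    have h3 := cs.length_mul_le (w * (u * cs.simple i)⁻¹) (u * cs.simple i)
    rw [inv_mul_cancel_right] at h3
    omega

theorem length_mul_add_of_isRightDescent {w : W} (hw : ∀ i ∈ K, cs.IsRightDescent w i)
    {v : W} (hv : v ∈ cs.parabolic K) : cs.length (w * v) + cs.length v = cs.length w := by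
  simpa using length_mul_inv_add_of_isRightDescent hw (inv_mem hv)

/-- The longest element of a parabolic subgroup is unique. -/
theorem eq_of_isRightDescent {v w : W} (hv : v ∈ cs.parabolic K) (hw : w ∈ cs.parabolic K)
    (hvK : ∀ i ∈ K, cs.IsRightDescent v i) (hwK : ∀ i ∈ K, cs.IsRightDescent w i) : v = w := by
  have h1 := length_mul_add_of_isRightDescent hvK (mul_mem (inv_mem hv) hw)
  have h2 := length_mul_add_of_isRightDescent hwK (mul_mem (inv_mem hw) hv)
  rw [mul_inv_cancel_left] at h1 h2
  have h3 : cs.length (v⁻¹ * w) = 0 := by omega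
  rw [length_eq_zero_iff, inv_mul_eq_one] at h3
  exact h3

/-! ### Words in two letters -/

theorem eq_alternatingWord_of_isReduced {a b : B} (ω : List B)
    (hω : ∀ i ∈ ω, i ∈ ({a, b} : Set B)) (hred : cs.IsReduced (ω ++ [a])) :
    ω = alternatingWord a b ω.length := by
  induction ω using List.reverseRecOn generalizing a b with
  | nil => rfl
  | append_singleton ω i ih =>
    have hi : i = b := by
      rcases hω i (by simp) with h | h
      · subst h
        have h1 := hred.length_wordProd_append_singleton
        have h2 := hred.of_append_left.length_wordProd_append_singleton
        rw [wordProd_append, wordProd_singleton, simple_mul_simple_cancel_right] at h1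
        omega
      · exact h
    subst hi
    have := ih (a := i) (b := a) (fun j hj => by
      rw [Set.pair_comm]; exact hω j (by simp [hj])) hred.of_append_left
    rw [List.length_append, List.length_singleton, alternatingWord_succ, ← this,
      List.concat_eq_append]

/-- A coincidence of the two alternating products bounds an order. It is used with the identity in
Matsumoto's theorem and with `hom` to compare with the type. -/
theorem map_mul_pow_eq_one_of_alternatingWord {G : Type*} [Group G] (f : W →* G) {a b : B} {k : ℕ}
    (h : f (cs.wordProd (alternatingWord a b k)) = f (cs.wordProd (alternatingWord b a k))) :
    (f (cs.simple a) * f (cs.simple b)) ^ k = 1 := by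
  rw [prod_alternatingWord_eq_mul_pow, prod_alternatingWord_eq_mul_pow] at h
  have hinv : ∀ n : ℕ, (cs.simple b * cs.simple a) ^ n = ((cs.simple a * cs.simple b) ^ n)⁻¹ := by
    intro n
    rw [← inv_pow]
    simp
  rw [hinv] at h
  rw [← map_mul, ← map_pow]
  obtain ⟨n, rfl | rfl⟩ := Nat.even_or_odd' k
  · rw [if_pos (by simp), if_pos (by simp), one_mul, one_mul, Nat.mul_div_cancel_left _ two_pos,
      map_inv, ← mul_eq_one_iff_eq_inv, ← map_mul, ← pow_add, ← two_mul] at h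
    exact h
  · rw [if_neg (by simp), if_neg (by simp), show (2 * n + 1) / 2 = n by omega, map_mul, map_mul,
      map_inv, ← mul_inv_eq_iff_eq_mul, inv_inv] at h
    have e : (cs.simple a * cs.simple b) ^ (2 * n + 1) = cs.simple a * (cs.simple b *
        (cs.simple a * cs.simple b) ^ n * (cs.simple a * cs.simple b) ^ n) := by
      rw [show 2 * n + 1 = 1 + (n + n) by ring, pow_add, pow_one, pow_add]
      simp only [mul_assoc]
    rw [e, map_mul, map_mul, map_mul, h, ← map_mul, simple_mul_simple_self, map_one]

theorem alternatingWord_of_isRightDescent {a b : B} {v : W} (hv : v ∈ cs.parabolic {a, b})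
    (h : cs.IsRightDescent v a) :
    cs.IsReduced (alternatingWord b a (cs.length v)) ∧
      cs.wordProd (alternatingWord b a (cs.length v)) = v := by
  obtain ⟨ω, hK, hω, e⟩ := exists_isReduced_of_mem_parabolic
    (mul_mem hv (simple_mem_parabolic (by simp : a ∈ ({a, b} : Set B))))
  have hω' : cs.IsReduced (ω ++ [a]) := by
    refine isReduced_append_singleton hω ?_
    rw [e, ← isRightDescent_iff_not_isRightDescent_mul]
    exact h
  have e' : cs.wordProd (ω ++ [a]) = v := by
    rw [wordProd_append, e, wordProd_singleton, simple_mul_simple_cancel_right]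
  have : alternatingWord b a (cs.length v) = ω ++ [a] := by
    rw [← e', hω'.eq, List.length_append, List.length_singleton, alternatingWord_succ,
      ← eq_alternatingWord_of_isReduced ω hK hω', List.concat_eq_append]
  rw [this]
  exact ⟨hω', e'⟩

theorem mem_of_mem_alternatingWord {a b i : B} {n : ℕ} (h : i ∈ alternatingWord a b n) :
    i = a ∨ i = b := by
  induction n generalizing a b with
  | zero => simp [alternatingWord] at h
  | succ n ih =>
    rw [alternatingWord_succ, List.concat_eq_append, List.mem_append, List.mem_singleton] at h
    rcases h with h | h
    · exact (ih h).symm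
    · exact Or.inr h

end CoxeterSystem

/-! ### Matsumoto's theorem on reduced words -/

namespace CoxeterMatrix

variable {I : Type*} (M : CoxeterMatrix I)

/-- **Matsumoto's theorem**, for words in a subset `K` of the vertices. -/
theorem map_prod_eq_of_isReduced {X : Type*} [Monoid X] (K : Set I) (g : I → X)
    (hg : ∀ i ∈ K, ∀ j ∈ K, M i j ≠ 0 →
      ((CoxeterSystem.braidWord M i j).map g).prod = ((CoxeterSystem.braidWord M j i).map g).prod)
    (ω ω' : List I) (hK : ∀ i ∈ ω, i ∈ K) (hK' : ∀ i ∈ ω', i ∈ K)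
    (hω : M.toCoxeterSystem.IsReduced ω) (hω' : M.toCoxeterSystem.IsReduced ω')
    (h : M.toCoxeterSystem.wordProd ω = M.toCoxeterSystem.wordProd ω') :
    (ω.map g).prod = (ω'.map g).prod := by
  induction hn : ω.length generalizing ω ω' with
  | zero =>
    have e : ω'.length = 0 := by rw [← hω'.eq, ← h, hω.eq, hn]
    rw [List.length_eq_zero_iff.mp hn, List.length_eq_zero_iff.mp e]
  | succ n ih =>
    have e : ω'.length = n + 1 := by rw [← hω'.eq, ← h, hω.eq, hn]
    obtain ⟨ω, i, rfl⟩ := (List.eq_nil_or_concat ω).resolve_left (by rintro rfl; simp at hn)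
    obtain ⟨ω', j, rfl⟩ := (List.eq_nil_or_concat ω').resolve_left (by rintro rfl; simp at e)
    simp only [List.concat_eq_append] at *
    simp only [List.length_append, List.length_singleton, Nat.add_right_cancel_iff] at hn e
    have same : ∀ (i : I) (τ τ' : List I), (∀ k ∈ τ ++ [i], k ∈ K) → (∀ k ∈ τ' ++ [i], k ∈ K) →
        M.toCoxeterSystem.IsReduced (τ ++ [i]) → M.toCoxeterSystem.IsReduced (τ' ++ [i]) →
        M.toCoxeterSystem.wordProd (τ ++ [i]) = M.toCoxeterSystem.wordProd (τ' ++ [i]) →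
        τ.length = n → ((τ ++ [i]).map g).prod = ((τ' ++ [i]).map g).prod := by
      intro i τ τ' h1 h2 h3 h4 h5 h6
      rw [CoxeterSystem.wordProd_append, CoxeterSystem.wordProd_append, mul_left_inj] at h5
      rw [List.map_append, List.map_append, List.prod_append, List.prod_append,
        ih τ τ' (fun k hk => h1 k (by simp [hk])) (fun k hk => h2 k (by simp [hk]))
        h3.of_append_left h4.of_append_left h5 h6]
    by_cases hij : i = j
    · subst hij
      exact same i ω ω' hK hK' hω hω' h hn
    set cs := M.toCoxeterSystem
    set w := cs.wordProd (ω ++ [i]) with hw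
    have hdi : cs.IsRightDescent w i := by
      have := hω.length_wordProd_append_singleton
      rw [hw, CoxeterSystem.IsRightDescent, CoxeterSystem.wordProd_append,
        CoxeterSystem.wordProd_singleton, CoxeterSystem.simple_mul_simple_cancel_right]
      omega
    have hdj : cs.IsRightDescent w j := by
      have := hω'.length_wordProd_append_singleton
      rw [h, CoxeterSystem.IsRightDescent, CoxeterSystem.wordProd_append,
        CoxeterSystem.wordProd_singleton, CoxeterSystem.simple_mul_simple_cancel_right]
      omega
    have hiK : i ∈ K := hK i (by simp)
    have hjK : j ∈ K := hK' j (by simp)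
    -- Both `i` and `j` are descents of the dihedral factor `v`, so two alternating words of length
    -- `ℓ(v)` with different last letters represent it. Hence `m_{i,j}` is finite and equals `ℓ(v)`.
    obtain ⟨x, v, hv, hxv, hadd⟩ := CoxeterSystem.exists_minimal_mul (cs := cs) {i, j} w
    have hdesc : ∀ k ∈ ({i, j} : Set I), cs.IsRightDescent w k → cs.IsRightDescent v k := by
      intro k hk hd
      rw [CoxeterSystem.IsRightDescent] at hd ⊢
      rw [hxv, mul_assoc, hadd v hv,
        hadd _ (mul_mem hv (CoxeterSystem.simple_mem_parabolic hk))] at hd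
      omega
    obtain ⟨ri, ei⟩ :=
      CoxeterSystem.alternatingWord_of_isRightDescent hv (hdesc i (by simp) hdi)
    obtain ⟨rj, ej⟩ := CoxeterSystem.alternatingWord_of_isRightDescent
      (by rwa [Set.pair_comm] at hv) (hdesc j (by simp) hdj)
    have hv0 : cs.length v ≠ 0 := by
      have := hdesc i (by simp) hdi
      rw [CoxeterSystem.IsRightDescent] at this
      omega
    have hdvd := M.dvd_of_simple_mul_simple_pow_eq_one
      (CoxeterSystem.map_mul_pow_eq_one_of_alternatingWord (cs := cs) (MonoidHom.id _)
        (ej.trans ei.symm))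
    have hM0 : M i j ≠ 0 := by
      intro h0
      rw [h0, zero_dvd_iff] at hdvd
      exact hv0 hdvd
    have hlen : cs.length v = M i j := by
      refine le_antisymm ?_ (Nat.le_of_dvd (Nat.pos_of_ne_zero hv0) hdvd)
      by_contra hlt
      exact cs.not_isReduced_alternatingWord i j hM0 (not_le.mp hlt) rj
    have hxK : x ∈ cs.parabolic K := by
      have hwK : w ∈ cs.parabolic K := CoxeterSystem.wordProd_mem_parabolic hK
      have hvK : v ∈ cs.parabolic K := CoxeterSystem.parabolic_mono
        (by rintro k (rfl | rfl) <;> assumption) hv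
      rw [eq_mul_inv_of_mul_eq hxv.symm]
      exact mul_mem hwK (inv_mem hvK)
    obtain ⟨ρ, hρK, hρ, rfl⟩ := CoxeterSystem.exists_isReduced_of_mem_parabolic hxK
    obtain ⟨m, hm⟩ := Nat.exists_eq_succ_of_ne_zero hM0
    have hbi : CoxeterSystem.braidWord M j i = CoxeterSystem.alternatingWord i j m ++ [i] := by
      rw [CoxeterSystem.braidWord, M.symmetric j i, hm, CoxeterSystem.alternatingWord_succ,
        List.concat_eq_append]
    have hbj : CoxeterSystem.braidWord M i j = CoxeterSystem.alternatingWord j i m ++ [j] := by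
      rw [CoxeterSystem.braidWord, hm, CoxeterSystem.alternatingWord_succ,
        List.concat_eq_append]
    rw [hlen] at ri ei rj ej
    have hbK : ∀ a b : I, a ∈ K → b ∈ K → ∀ n,
        ∀ k ∈ ρ ++ CoxeterSystem.alternatingWord a b n, k ∈ K := by
      intro a b ha hb n k hk
      rcases List.mem_append.mp hk with hk | hk
      · exact hρK k hk
      · rcases CoxeterSystem.mem_of_mem_alternatingWord hk with rfl | rfl <;> assumption
    have hwi : w = cs.wordProd (ρ ++ CoxeterSystem.alternatingWord j i (M i j)) := by
      rw [CoxeterSystem.wordProd_append, ei, hxv]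
    have hwj : w = cs.wordProd (ρ ++ CoxeterSystem.alternatingWord i j (M i j)) := by
      rw [CoxeterSystem.wordProd_append, ej, hxv]
    have hlw : cs.length w = ρ.length + M i j := by rw [hxv, hadd v hv, hρ.eq, hlen]
    have hri : cs.IsReduced (ρ ++ CoxeterSystem.alternatingWord j i (M i j)) := by
      rw [CoxeterSystem.IsReduced, ← hwi, hlw]
      simp
    have hrj : cs.IsReduced (ρ ++ CoxeterSystem.alternatingWord i j (M i j)) := by
      rw [CoxeterSystem.IsReduced, ← hwj, hlw]
      simp
    have hKi := hbK j i hjK hiK (M i j)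
    have hKj := hbK i j hiK hjK (M i j)
    have hbraid := hg i hiK j hjK hM0
    rw [M.symmetric i j, ← CoxeterSystem.braidWord, hbi, ← List.append_assoc] at hwi hri hKi
    rw [← CoxeterSystem.braidWord, hbj, ← List.append_assoc] at hwj hrj hKj
    -- Each word is compared by induction with `ρ` followed by the braid word having the same last
    -- letter; one braid relation joins these two.
    rw [same i _ _ hK hKi hω hri hwi hn, same j _ _ hK' hKj hω' hrj (h.symm.trans hwj) e,
      List.append_assoc, List.append_assoc, ← hbi, ← hbj, List.map_append, List.map_append,
      List.prod_append, List.prod_append, hbraid]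

end CoxeterMatrix

namespace CoxeterMatrix

variable {I : Type*} (M : CoxeterMatrix I)

/-! ### Lifts of elements of the Coxeter group to the Artin-Tits monoid -/

theorem artinWord_append (ω ω' : List I) :
    M.artinWord (ω ++ ω') = M.artinWord ω * M.artinWord ω' := by
  simp [artinWord]

theorem artinWord_eq_mk (ω : List I) :
    M.artinWord ω = PresentedMonoid.mk M.ArtinRel (FreeMonoid.ofList ω) := by
  induction ω with
  | nil => simp [artinWord]
  | cons i ω ih =>
    rw [FreeMonoid.ofList_cons, map_mul, ← ih]
    simp [artinWord, artinGen, PresentedMonoid.of]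

theorem artinWord_braidWord {i j : I} (h : M i j ≠ 0) :
    M.artinWord (CoxeterSystem.braidWord M i j) = M.artinWord (CoxeterSystem.braidWord M j i) := by
  rw [artinWord_eq_mk, artinWord_eq_mk]
  exact PresentedMonoid.mk_eq_mk_of_rel (ArtinRel.braid i j h)

theorem simpleLift_wordProd {ω : List I} (hω : M.toCoxeterSystem.IsReduced ω) :
    M.simpleLift (M.toCoxeterSystem.wordProd ω) = M.artinWord ω := by
  obtain ⟨h1, h2⟩ :=
    (M.toCoxeterSystem.exists_isReduced (M.toCoxeterSystem.wordProd ω)).choose_spec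
  exact M.map_prod_eq_of_isReduced Set.univ M.artinGen
    (fun i _ j _ h => M.artinWord_braidWord h) _ _ (by simp) (by simp) h1 hω h2.symm

theorem simpleLift_one : M.simpleLift 1 = 1 := by
  have : M.toCoxeterSystem.IsReduced [] := by simp [CoxeterSystem.IsReduced]
  have := M.simpleLift_wordProd this
  rwa [CoxeterSystem.wordProd_nil] at this

theorem simpleLift_mul {u v : M.Group} (h : M.len (u * v) = M.len u + M.len v) :
    M.simpleLift (u * v) = M.simpleLift u * M.simpleLift v := by
  obtain ⟨ω, hω, rfl⟩ := M.toCoxeterSystem.exists_isReduced u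
  obtain ⟨ω', hω', rfl⟩ := M.toCoxeterSystem.exists_isReduced v
  have hr : M.toCoxeterSystem.IsReduced (ω ++ ω') := by
    rw [CoxeterSystem.IsReduced, CoxeterSystem.wordProd_append]
    refine Eq.trans h ?_
    rw [len, len, hω.eq, hω'.eq, List.length_append]
  rw [← CoxeterSystem.wordProd_append, simpleLift_wordProd _ hr, simpleLift_wordProd _ hω,
    simpleLift_wordProd _ hω', artinWord_append]

/-- The projection of the Artin-Tits monoid to the Coxeter group. -/
def artinToGroup : M.ArtinMonoid →* M.Group :=
  PresentedMonoid.lift M.toCoxeterSystem.simple (by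
    rintro _ _ ⟨i, j, h⟩
    rw [FreeMonoid.lift_ofList, FreeMonoid.lift_ofList]
    exact M.toCoxeterSystem.wordProd_braidWord_eq i j)

theorem artinToGroup_artinWord (ω : List I) :
    M.artinToGroup (M.artinWord ω) = M.toCoxeterSystem.wordProd ω := by
  rw [artinWord, map_list_prod, List.map_map]
  rfl

theorem artinToGroup_simpleLift (w : M.Group) : M.artinToGroup (M.simpleLift w) = w := by
  rw [simpleLift, artinToGroup_artinWord]
  exact (M.toCoxeterSystem.exists_isReduced w).choose_spec.2.symm

/-! ### Longest elements of spherical parabolic subgroups -/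

variable {M} {K : Set I}

theorem parabolic_eq : M.parabolic K = M.toCoxeterSystem.parabolic K := by
  rw [parabolic, CoxeterSystem.parabolic, toCoxeterSystem_simple]

theorem len_eq (w : M.Group) : M.len w = M.toCoxeterSystem.length w := rfl

/-- Maximality becomes a local condition on descents, because every element of the parabolic
subgroup is a suffix of an element having all of `K` as descents. -/
theorem isLongest_iff {r : M.Group} : M.IsLongest K r ↔
    r ∈ M.toCoxeterSystem.parabolic K ∧ ∀ i ∈ K, M.toCoxeterSystem.IsRightDescent r i := by
  rw [IsLongest, parabolic_eq]
  simp only [len_eq]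
  constructor
  · rintro ⟨h1, h2⟩
    refine ⟨h1, fun i hi => ?_⟩
    have h3 := h2 (r * M.toCoxeterSystem.simple i)
      (mul_mem h1 (CoxeterSystem.simple_mem_parabolic hi))
    have h4 := M.toCoxeterSystem.length_mul_simple_ne r i
    exact lt_of_le_of_ne h3 h4
  · rintro ⟨h1, h2⟩
    refine ⟨h1, fun w hw => ?_⟩
    have := CoxeterSystem.length_mul_add_of_isRightDescent h2 hw
    omega

theorem IsLongest.eq {r r' : M.Group} (h : M.IsLongest K r) (h' : M.IsLongest K r') : r = r' := by
  rw [isLongest_iff] at h h'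
  exact CoxeterSystem.eq_of_isRightDescent h.1 h'.1 h.2 h'.2

theorem IsLongest.longest_eq {r : M.Group} (h : M.IsLongest K r) : M.longest K = r :=
  IsLongest.eq (Classical.epsilon_spec ⟨r, h⟩) h

theorem IsLongest.mul_self {r : M.Group} (h : M.IsLongest K r) : r * r = 1 := by
  have h' : M.IsLongest K r⁻¹ :=
    ⟨inv_mem h.1, fun w hw => (h.2 w hw).trans_eq (M.toCoxeterSystem.length_inv r).symm⟩
  rw [mul_eq_one_iff_eq_inv]
  exact h.eq h'

theorem IsSpherical.longest_mem (h : M.IsSpherical K) :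
    M.longest K ∈ M.toCoxeterSystem.parabolic K := (isLongest_iff.mp (M.isLongest_longest h)).1

theorem IsSpherical.isRightDescent_longest (h : M.IsSpherical K) {i : I} (hi : i ∈ K) :
    M.toCoxeterSystem.IsRightDescent (M.longest K) i :=
  (isLongest_iff.mp (M.isLongest_longest h)).2 i hi

/-- The right descents of an element of a parabolic subgroup belong to its type. -/
theorem mem_of_isRightDescent {v : M.Group} (hv : v ∈ M.toCoxeterSystem.parabolic K) {i : I}
    (h : M.toCoxeterSystem.IsRightDescent v i) : i ∈ K := by
  obtain ⟨ω, hK, hω, rfl⟩ := CoxeterSystem.exists_isReduced_of_mem_parabolic hv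
  obtain ⟨-, j, -, e⟩ :=
    M.toCoxeterSystem.exists_wordProd_eraseIdx (M.toCoxeterSystem.isReflection_simple i) h
  have hs : M.toCoxeterSystem.simple i ∈ M.toCoxeterSystem.parabolic K := by
    rw [eq_inv_mul_of_mul_eq e]
    exact mul_mem (inv_mem hv) (CoxeterSystem.wordProd_mem_parabolic
      fun k hk => hK k (List.mem_of_mem_eraseIdx hk))
  obtain ⟨τ, hτK, hτ, e'⟩ := CoxeterSystem.exists_isReduced_of_mem_parabolic hs
  have hl := hτ.eq
  rw [e', CoxeterSystem.length_simple, eq_comm, List.length_eq_one_iff] at hl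
  obtain ⟨k, rfl⟩ := hl
  rw [CoxeterSystem.wordProd_singleton] at e'
  rw [← M.simple_injective e']
  exact hτK k (by simp)

/-- If a parabolic subgroup has an element with maximal right descent set, then it is finite. -/
theorem isSpherical_of_isRightDescent {r : M.Group}
    (hr : ∀ i ∈ K, M.toCoxeterSystem.IsRightDescent r i) : M.IsSpherical K := by
  obtain ⟨ω, rfl⟩ := M.toCoxeterSystem.wordProd_surjective r
  -- The vertices may be infinite in number, but each `s_i` with `i ∈ K` occurs in the inversion
  -- sequence of one fixed word. Since the elements of `W_K` also have length at most `ℓ(r)`,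
  -- finitely many words suffice.
  have hfin : K.Finite := by
    refine Set.Finite.of_finite_image (f := M.toCoxeterSystem.simple) ?_
      M.simple_injective.injOn
    refine (List.finite_toSet (M.toCoxeterSystem.rightInvSeq ω)).subset ?_
    rintro _ ⟨i, hi, rfl⟩
    exact (M.toCoxeterSystem.exists_wordProd_eraseIdx
      (M.toCoxeterSystem.isReflection_simple i) (hr i hi)).1
  have := hfin.to_subtype
  rw [IsSpherical, parabolic_eq]
  refine Set.Finite.subset ((List.finite_length_le K
    (M.toCoxeterSystem.length (M.toCoxeterSystem.wordProd ω))).image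
      fun τ => M.toCoxeterSystem.wordProd (τ.map Subtype.val)) ?_
  intro v hv
  have hle := CoxeterSystem.length_mul_add_of_isRightDescent hr hv
  obtain ⟨τ, hτK, hτ, rfl⟩ := CoxeterSystem.exists_isReduced_of_mem_parabolic hv
  lift τ to List K using hτK
  refine ⟨τ, ?_, rfl⟩
  have := hτ.eq
  rw [List.length_map] at this
  simp only [Set.mem_ofPred_eq]
  omega

/-! ### Restriction to a subset of the vertices -/

variable (M) (J : Set I)

/-- The morphism from the Coxeter group of `Γ_J` to that of `Γ`. -/
def restrictHom : (M.restrict J).Group →* M.Group :=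
  (M.restrict J).toCoxeterSystem.lift ⟨fun i => M.toCoxeterSystem.simple i,
    fun i j => M.toCoxeterSystem.simple_mul_simple_pow i j⟩

theorem restrictHom_simple (i : J) :
    M.restrictHom J ((M.restrict J).toCoxeterSystem.simple i) = M.toCoxeterSystem.simple i :=
  CoxeterSystem.lift_apply_simple _ _ i

theorem restrictHom_wordProd (ω : List J) :
    M.restrictHom J ((M.restrict J).toCoxeterSystem.wordProd ω) =
      M.toCoxeterSystem.wordProd (ω.map Subtype.val) := by
  induction ω with
  | nil => simp
  | cons i ω ih =>
    rw [CoxeterSystem.wordProd_cons, map_mul, ih, restrictHom_simple, List.map_cons,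
      CoxeterSystem.wordProd_cons]

theorem alternatingWord_map {A B : Type*} (f : A → B) (a b : A) (n : ℕ) :
    (CoxeterSystem.alternatingWord a b n).map f =
      CoxeterSystem.alternatingWord (f a) (f b) n := by
  induction n generalizing a b with
  | zero => rfl
  | succ n ih => simp [CoxeterSystem.alternatingWord_succ, ih]

theorem wordProd_eq_of_map_eq {ω ω' : List J}
    (hω : M.toCoxeterSystem.IsReduced (ω.map Subtype.val))
    (hω' : M.toCoxeterSystem.IsReduced (ω'.map Subtype.val))
    (h : M.toCoxeterSystem.wordProd (ω.map Subtype.val) =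
      M.toCoxeterSystem.wordProd (ω'.map Subtype.val)) :
    (M.restrict J).toCoxeterSystem.wordProd ω = (M.restrict J).toCoxeterSystem.wordProd ω' := by
  classical
  -- Matsumoto's theorem is applied in `W_Γ` to words in `J`, with values in the Coxeter group of
  -- `Γ_J`; the value `1` outside `J` plays no role.
  let g : I → (M.restrict J).Group := fun i =>
    if hi : i ∈ J then (M.restrict J).toCoxeterSystem.simple ⟨i, hi⟩ else 1
  have hg : ∀ τ : List J, ((τ.map Subtype.val).map g).prod =
      (M.restrict J).toCoxeterSystem.wordProd τ := by
    intro τ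
    rw [List.map_map, CoxeterSystem.wordProd]
    congr 2
    ext i
    simp [g]
  have hmem : ∀ τ : List J, ∀ i ∈ τ.map Subtype.val, i ∈ J := by
    simp only [List.mem_map]
    rintro τ _ ⟨i, -, rfl⟩
    exact i.2
  have := M.map_prod_eq_of_isReduced J g ?_ _ _ (hmem ω) (hmem ω') hω hω' h
  · rwa [hg, hg] at this
  · intro i hi j hj _
    have e := (M.restrict J).toCoxeterSystem.wordProd_braidWord_eq ⟨i, hi⟩ ⟨j, hj⟩
    rw [← hg, ← hg, CoxeterSystem.braidWord, CoxeterSystem.braidWord,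
      alternatingWord_map Subtype.val, alternatingWord_map Subtype.val] at e
    exact e

/-- A letter `i` that became a descent in `W_Γ` would give a reduced word over `J` ending in `i`. By
`wordProd_eq_of_map_eq` this word represents the same element for `Γ_J`, so `i` would be a descent
there too. -/
theorem isReduced_map_val {ω : List J} (hω : (M.restrict J).toCoxeterSystem.IsReduced ω) :
    M.toCoxeterSystem.IsReduced (ω.map Subtype.val) := by
  induction ω using List.reverseRecOn with
  | nil => simp [CoxeterSystem.IsReduced]
  | append_singleton ω i ih =>
    specialize ih hω.of_append_left
    rw [List.map_append]
    refine CoxeterSystem.isReduced_append_singleton ih fun hd => ?_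
    have hmem : ∀ k ∈ ω.map Subtype.val, k ∈ J := by
      simp only [List.mem_map]
      rintro _ ⟨k, -, rfl⟩
      exact k.2
    obtain ⟨τ, hτJ, hτ, e⟩ := CoxeterSystem.exists_isReduced_of_mem_parabolic
      (mul_mem (CoxeterSystem.wordProd_mem_parabolic (cs := M.toCoxeterSystem) hmem)
        (CoxeterSystem.simple_mem_parabolic i.2))
    lift τ to List J using hτJ
    have hτ' : M.toCoxeterSystem.IsReduced ((τ ++ [i]).map Subtype.val) := by
      rw [List.map_append]
      refine CoxeterSystem.isReduced_append_singleton hτ ?_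
      rwa [e, ← CoxeterSystem.isRightDescent_iff_not_isRightDescent_mul]
    have e' := M.wordProd_eq_of_map_eq J ih hτ' (by
      rw [List.map_append, CoxeterSystem.wordProd_append, e, List.map_singleton,
        CoxeterSystem.wordProd_singleton, CoxeterSystem.simple_mul_simple_cancel_right])
    have h1 := hω.length_wordProd_append_singleton
    rw [e', CoxeterSystem.wordProd_append, CoxeterSystem.wordProd_singleton,
      CoxeterSystem.simple_mul_simple_cancel_right, ← CoxeterSystem.wordProd_singleton,
      ← CoxeterSystem.wordProd_append, ← e', hω.of_append_left.eq] at h1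
    have h2 := (M.restrict J).toCoxeterSystem.length_wordProd_le τ
    have h3 := hτ'.eq
    rw [List.map_append, CoxeterSystem.wordProd_append, e] at h3
    simp only [List.map_cons, List.map_nil, CoxeterSystem.wordProd_singleton,
      CoxeterSystem.simple_mul_simple_cancel_right, ih.eq, List.length_append, List.length_map,
      List.length_singleton] at h3
    omega

theorem length_restrictHom (w : (M.restrict J).Group) :
    M.toCoxeterSystem.length (M.restrictHom J w) = (M.restrict J).toCoxeterSystem.length w := by
  obtain ⟨ω, hω, rfl⟩ := (M.restrict J).toCoxeterSystem.exists_isReduced w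
  rw [restrictHom_wordProd, (M.isReduced_map_val J hω).eq, hω.eq, List.length_map]

theorem restrictHom_injective : Function.Injective (M.restrictHom J) := by
  rw [injective_iff_map_eq_one]
  intro w hw
  rw [← (M.restrict J).toCoxeterSystem.length_eq_zero_iff, ← length_restrictHom, hw]
  simp

theorem isRightDescent_restrictHom {w : (M.restrict J).Group} {i : J} :
    M.toCoxeterSystem.IsRightDescent (M.restrictHom J w) i ↔
      (M.restrict J).toCoxeterSystem.IsRightDescent w i := by
  rw [CoxeterSystem.IsRightDescent, CoxeterSystem.IsRightDescent, ← restrictHom_simple, ← map_mul,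
    length_restrictHom, length_restrictHom]

theorem map_parabolic (α : Set J) :
    ((M.restrict J).toCoxeterSystem.parabolic α).map (M.restrictHom J) =
      M.toCoxeterSystem.parabolic (Subtype.val '' α) := by
  rw [CoxeterSystem.parabolic, MonoidHom.map_closure, CoxeterSystem.parabolic, Set.image_image,
    Set.image_image]
  simp only [restrictHom_simple]

theorem isSpherical_image {α : Set J} (h : (M.restrict J).IsSpherical α) :
    M.IsSpherical (Subtype.val '' α) := by
  rw [IsSpherical, parabolic_eq] at h ⊢
  rw [← map_parabolic, Subgroup.coe_map]
  exact h.image _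

theorem restrictHom_longest {α : Set J} (h : (M.restrict J).IsSpherical α) :
    M.restrictHom J ((M.restrict J).longest α) = M.longest (Subtype.val '' α) := by
  symm
  apply IsLongest.longest_eq
  rw [isLongest_iff, ← map_parabolic]
  refine ⟨Subgroup.mem_map_of_mem _ h.longest_mem, ?_⟩
  rintro _ ⟨i, hi, rfl⟩
  rw [isRightDescent_restrictHom]
  exact h.isRightDescent_longest hi

end CoxeterMatrix

namespace CoxeterMatrix

variable {I A : Type*} {M : CoxeterMatrix I} {K : A → Set I}

/-! ### Admissible families of spherical subsets -/

/-- A family of disjoint non-empty spherical subsets of the vertices is admissible if for every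
element `w` of the subgroup generated by their longest elements, each member of the family consists
of right ascents of `w` or of right descents of `w`. -/
structure IsAdmissibleFamily (M : CoxeterMatrix I) (K : A → Set I) : Prop where
  nonempty : ∀ a, (K a).Nonempty
  disjoint : ∀ a b, a ≠ b → Disjoint (K a) (K b)
  spherical : ∀ a, M.IsSpherical (K a)
  dichotomy : ∀ w ∈ Subgroup.closure (Set.range fun a => M.longest (K a)), ∀ a,
    (∀ i ∈ K a, ¬ M.toCoxeterSystem.IsRightDescent w i) ∨
      ∀ i ∈ K a, M.toCoxeterSystem.IsRightDescent w i

namespace IsAdmissibleFamily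

theorem longest_mul_self (hK : M.IsAdmissibleFamily K) (a : A) :
    M.longest (K a) * M.longest (K a) = 1 :=
  (M.isLongest_longest (hK.spherical a)).mul_self

theorem longest_inv (hK : M.IsAdmissibleFamily K) (a : A) :
    (M.longest (K a))⁻¹ = M.longest (K a) :=
  inv_eq_of_mul_eq_one_left (hK.longest_mul_self a)

/-- Descents of `r_a` lie in `K a`, whereas all of the non-empty set `K b` are descents of `r_b`. -/
theorem longest_injective (hK : M.IsAdmissibleFamily K) {a b : A}
    (h : M.longest (K a) = M.longest (K b)) : a = b := by
  by_contra hab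
  obtain ⟨i, hi⟩ := hK.nonempty b
  have h1 := (hK.spherical b).isRightDescent_longest hi
  rw [← h] at h1
  have h2 := mem_of_isRightDescent (hK.spherical a).longest_mem h1
  exact Set.disjoint_left.mp (hK.disjoint a b hab) h2 hi

/-- The type of an admissible family. -/
noncomputable def type (hK : M.IsAdmissibleFamily K) : CoxeterMatrix A where
  M := fun a b => orderOf (M.longest (K a) * M.longest (K b))
  isSymm := by
    ext a b
    change orderOf (M.longest (K b) * M.longest (K a)) = _
    rw [← orderOf_inv, mul_inv_rev, hK.longest_inv, hK.longest_inv]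
  diagonal := fun a => by rw [hK.longest_mul_self, orderOf_one]
  off_diagonal := fun a b hab h => by
    rw [orderOf_eq_one_iff, mul_eq_one_iff_eq_inv, hK.longest_inv] at h
    exact hab (hK.longest_injective h)

theorem type_apply (hK : M.IsAdmissibleFamily K) (a b : A) :
    hK.type a b = orderOf (M.longest (K a) * M.longest (K b)) := rfl

/-- The morphism from the Coxeter group of the type, sending the generators to the longest
elements of the members of the family. -/
noncomputable def hom (hK : M.IsAdmissibleFamily K) : hK.type.Group →* M.Group :=
  hK.type.toCoxeterSystem.lift ⟨fun a => M.longest (K a), fun _ _ => pow_orderOf_eq_one _⟩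

theorem hom_simple (hK : M.IsAdmissibleFamily K) (a : A) :
    hK.hom (hK.type.toCoxeterSystem.simple a) = M.longest (K a) :=
  CoxeterSystem.lift_apply_simple _ _ a

theorem range_hom (hK : M.IsAdmissibleFamily K) :
    hK.hom.range = Subgroup.closure (Set.range fun a => M.longest (K a)) := by
  rw [MonoidHom.range_eq_map, ← hK.type.toCoxeterSystem.subgroup_closure_range_simple,
    MonoidHom.map_closure, ← Set.range_comp]
  congr 2
  ext a
  exact hK.hom_simple a

theorem hom_dichotomy (hK : M.IsAdmissibleFamily K) (w : hK.type.Group) (a : A) :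
    (∀ i ∈ K a, ¬ M.toCoxeterSystem.IsRightDescent (hK.hom w) i) ∨
      ∀ i ∈ K a, M.toCoxeterSystem.IsRightDescent (hK.hom w) i :=
  hK.dichotomy _ (hK.range_hom ▸ ⟨w, rfl⟩) a

/-- `a` is an ascent of `w` if the set of right ascents of its image contains `K a`. -/
def IsAscent (hK : M.IsAdmissibleFamily K) (w : hK.type.Group) (a : A) : Prop :=
  ∀ i ∈ K a, ¬ M.toCoxeterSystem.IsRightDescent (hK.hom w) i

theorem IsAscent.length_hom_mul {hK : M.IsAdmissibleFamily K} {w : hK.type.Group} {a : A}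
    (h : hK.IsAscent w a) :
    M.toCoxeterSystem.length (hK.hom (w * hK.type.toCoxeterSystem.simple a)) =
      M.toCoxeterSystem.length (hK.hom w) + M.toCoxeterSystem.length (M.longest (K a)) := by
  rw [map_mul, hom_simple]
  exact CoxeterSystem.length_mul_of_not_isRightDescent h (hK.spherical a).longest_mem

theorem IsAscent.isRightDescent {hK : M.IsAdmissibleFamily K} {w : hK.type.Group} {a : A}
    (h : hK.IsAscent w a) {i : I} (hi : i ∈ K a) :
    M.toCoxeterSystem.IsRightDescent (hK.hom (w * hK.type.toCoxeterSystem.simple a)) i := by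
  have hd := (hK.spherical a).isRightDescent_longest hi
  have h1 := h.length_hom_mul
  rw [CoxeterSystem.IsRightDescent] at hd ⊢
  rw [h1, map_mul, hom_simple, mul_assoc,
    CoxeterSystem.length_mul_of_not_isRightDescent h
      (mul_mem (hK.spherical a).longest_mem (CoxeterSystem.simple_mem_parabolic hi))]
  omega

theorem hom_mem_parabolic (hK : M.IsAdmissibleFamily K) {a b : A} {v : hK.type.Group}
    (hv : v ∈ hK.type.toCoxeterSystem.parabolic {a, b}) :
    hK.hom v ∈ M.toCoxeterSystem.parabolic (K a ∪ K b) := by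
  induction hv using CoxeterSystem.parabolic_induction with
  | one => rw [map_one]; exact one_mem _
  | mul v hv c hc ih =>
    rw [map_mul, hom_simple]
    refine mul_mem ih ?_
    rcases hc with rfl | rfl
    · exact CoxeterSystem.parabolic_mono Set.subset_union_left (hK.spherical _).longest_mem
    · exact CoxeterSystem.parabolic_mono Set.subset_union_right (hK.spherical _).longest_mem

/-! ### Alternating products of two longest elements -/

/-- The expected length of the image of an alternating word. -/
noncomputable def altLength (M : CoxeterMatrix I) (K : A → Set I) : A → A → ℕ → ℕ
  | _, _, 0 => 0
  | a, b, k + 1 => altLength M K b a k + M.toCoxeterSystem.length (M.longest (K b))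

/-- The right-hand side is the expected length for `k + 1` factors ending in `b`, so this is strict
growth in the number of factors. -/
theorem altLength_lt (hK : M.IsAdmissibleFamily K) (a b : A) (k : ℕ) :
    altLength M K a b k <
      altLength M K b a k + M.toCoxeterSystem.length (M.longest (K b)) := by
  have hpos : ∀ b, 0 < M.toCoxeterSystem.length (M.longest (K b)) := by
    intro b
    obtain ⟨i, hi⟩ := hK.nonempty b
    have := (hK.spherical b).isRightDescent_longest hi
    rw [CoxeterSystem.IsRightDescent] at this
    omega
  induction k generalizing a b with
  | zero => simpa [altLength] using hpos b
  | succ k ih =>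
    have := ih b a
    rw [altLength, altLength]
    omega

/-- The product of the alternating word of length `k` in `a` and `b` ending in `b`. -/
noncomputable def alt (hK : M.IsAdmissibleFamily K) (a b : A) (k : ℕ) : hK.type.Group :=
  hK.type.toCoxeterSystem.wordProd (CoxeterSystem.alternatingWord a b k)

theorem alt_succ (hK : M.IsAdmissibleFamily K) (a b : A) (k : ℕ) :
    hK.alt a b (k + 1) = hK.alt b a k * hK.type.toCoxeterSystem.simple b := by
  rw [alt, CoxeterSystem.alternatingWord_succ, CoxeterSystem.wordProd_concat, alt]

theorem alt_mem_parabolic (hK : M.IsAdmissibleFamily K) (a b : A) (k : ℕ) :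
    hK.alt a b k ∈ hK.type.toCoxeterSystem.parabolic {a, b} :=
  CoxeterSystem.wordProd_mem_parabolic fun _ h => CoxeterSystem.mem_of_mem_alternatingWord h

theorem length_hom_alt (hK : M.IsAdmissibleFamily K) {a b : A} {k : ℕ}
    (h : ∀ j < k, hK.IsAscent (hK.alt a b j) a ∧ hK.IsAscent (hK.alt b a j) b) :
    M.toCoxeterSystem.length (hK.hom (hK.alt a b k)) = altLength M K a b k := by
  induction k generalizing a b with
  | zero => simp [alt, altLength, CoxeterSystem.alternatingWord]
  | succ k ih =>
    rw [alt_succ, (h k (by omega)).2.length_hom_mul, altLength,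
      ih fun j hj => (h j (by omega)).symm]

/-- When `a` first fails to be an ascent, admissibility makes `K a` descents and the last factor
makes `K b` descents: the product is the longest element for `K a ∪ K b`. The other alternating
product must stop at the same `k`, as otherwise its next step would exceed the maximal length.
Uniqueness identifies the two products. -/
theorem type_dvd_of_not_isAscent (hK : M.IsAdmissibleFamily K) {a b : A} {k : ℕ}
    (h : ∀ j < k, hK.IsAscent (hK.alt a b j) a ∧ hK.IsAscent (hK.alt b a j) b)
    (hk : ¬ hK.IsAscent (hK.alt a b k) a) : k ≠ 0 ∧ hK.type a b ∣ k := by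
  have hk0 : k ≠ 0 := by
    rintro rfl
    refine hk fun i _ => ?_
    rw [alt, CoxeterSystem.alternatingWord, CoxeterSystem.wordProd_nil, map_one]
    exact M.toCoxeterSystem.not_isRightDescent_one i
  refine ⟨hk0, ?_⟩
  have desc : ∀ a b, (∀ j < k, hK.IsAscent (hK.alt a b j) a ∧ hK.IsAscent (hK.alt b a j) b) →
      ¬ hK.IsAscent (hK.alt a b k) a →
      ∀ i ∈ K a ∪ K b, M.toCoxeterSystem.IsRightDescent (hK.hom (hK.alt a b k)) i := by
    intro a b h hk i hi
    rcases hi with hi | hi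
    · exact (hK.hom_dichotomy _ a).resolve_left hk i hi
    · obtain ⟨m, rfl⟩ := Nat.exists_eq_succ_of_ne_zero hk0
      rw [Nat.succ_eq_add_one, alt_succ]
      exact (h m (by omega)).2.isRightDescent hi
  have hab := desc a b h hk
  have hmem := hK.hom_mem_parabolic (hK.alt_mem_parabolic a b k)
  -- One more factor would give an element of the same parabolic subgroup longer than its longest
  -- one.
  have hk' : ¬ hK.IsAscent (hK.alt b a k) b := by
    intro hasc
    have h1 := hasc.length_hom_mul
    rw [← alt_succ, hK.length_hom_alt fun j hj => (h j hj).symm] at h1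
    have h2 := hK.altLength_lt a b k
    have h3 := (isLongest_iff.mpr ⟨hmem, hab⟩).2 (hK.hom (hK.alt a b (k + 1))) (by
      rw [parabolic_eq]
      exact hK.hom_mem_parabolic (hK.alt_mem_parabolic a b (k + 1)))
    rw [len_eq, len_eq, hK.length_hom_alt h] at h3
    omega
  have hba := desc b a (fun j hj => (h j hj).symm) hk'
  have hmem' := hK.hom_mem_parabolic (hK.alt_mem_parabolic b a k)
  rw [Set.union_comm] at hba hmem'
  have e := CoxeterSystem.eq_of_isRightDescent hmem hmem' hab hba
  have := CoxeterSystem.map_mul_pow_eq_one_of_alternatingWord hK.hom e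
  rw [hom_simple, hom_simple] at this
  exact orderOf_dvd_of_pow_eq_one this

theorem isAscent_alt (hK : M.IsAdmissibleFamily K) {a b : A} {k : ℕ}
    (hk : hK.type a b = 0 ∨ k < hK.type a b) :
    hK.IsAscent (hK.alt a b k) a ∧ hK.IsAscent (hK.alt b a k) b := by
  induction k using Nat.strong_induction_on with
  | _ k ih =>
    have h : ∀ j < k, hK.IsAscent (hK.alt a b j) a ∧ hK.IsAscent (hK.alt b a j) b :=
      fun j hj => ih j hj (by omega)
    have key : ∀ n, n = hK.type a b → n ∣ k → k ≠ 0 → False := by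
      rintro n rfl hdvd hk0
      rcases hk with hk | hk
      · rw [hk, zero_dvd_iff] at hdvd
        exact hk0 hdvd
      · exact absurd (Nat.le_of_dvd (Nat.pos_of_ne_zero hk0) hdvd) (not_le.mpr hk)
    constructor
    · by_contra hc
      obtain ⟨h0, hd⟩ := hK.type_dvd_of_not_isAscent h hc
      exact key _ rfl hd h0
    · by_contra hc
      obtain ⟨h0, hd⟩ := hK.type_dvd_of_not_isAscent (fun j hj => (h j hj).symm) hc
      exact key _ (hK.type.symmetric b a) hd h0

/-- The ascents in the Coxeter group of the type are ascents in the ambient Coxeter group. -/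
theorem isAscent_of_not_isRightDescent (hK : M.IsAdmissibleFamily K) {w : hK.type.Group} {a : A}
    (h : ¬ hK.type.toCoxeterSystem.IsRightDescent w a) : hK.IsAscent w a := by
  induction hn : hK.type.toCoxeterSystem.length w using Nat.strong_induction_on
    generalizing w a with
  | _ n ih =>
    by_cases hw : w = 1
    · subst hw
      intro i _
      rw [map_one]
      exact M.toCoxeterSystem.not_isRightDescent_one i
    obtain ⟨b, hb⟩ := hK.type.toCoxeterSystem.exists_rightDescent_of_ne_one hw
    obtain ⟨x, v, hv, rfl, hadd⟩ :=
      CoxeterSystem.exists_minimal_mul (cs := hK.type.toCoxeterSystem) {a, b} w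
    have hsimple : ∀ c ∈ ({a, b} : Set A),
        hK.type.toCoxeterSystem.simple c ∈ hK.type.toCoxeterSystem.parabolic {a, b} :=
      fun c hc => CoxeterSystem.simple_mem_parabolic hc
    have hdesc : ∀ c ∈ ({a, b} : Set A), (hK.type.toCoxeterSystem.IsRightDescent (x * v) c ↔
        hK.type.toCoxeterSystem.IsRightDescent v c) := by
      intro c hc
      rw [CoxeterSystem.IsRightDescent, CoxeterSystem.IsRightDescent, mul_assoc, hadd v hv,
        hadd _ (mul_mem hv (hsimple c hc))]
      omega
    rw [hdesc b (by simp)] at hb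
    rw [hdesc a (by simp)] at h
    -- The descent `b` forces `v ≠ 1`, so `x` is strictly shorter than the original element and the
    -- induction hypothesis applies.
    have hxasc : ∀ c ∈ ({a, b} : Set A), hK.IsAscent x c := by
      intro c hc
      refine ih (hK.type.toCoxeterSystem.length x) ?_ ?_ rfl
      · rw [← hn, hadd v hv]
        have : hK.type.toCoxeterSystem.length v ≠ 0 := by
          rw [CoxeterSystem.IsRightDescent] at hb
          omega
        omega
      · rw [CoxeterSystem.IsRightDescent, hadd _ (hsimple c hc)]
        omega
    obtain ⟨ω, hω, hred, rfl⟩ := CoxeterSystem.exists_isReduced_of_mem_parabolic hv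
    have hred' := CoxeterSystem.isReduced_append_singleton hred h
    have hω' := CoxeterSystem.eq_alternatingWord_of_isReduced ω hω hred'
    have hv' : hK.type.toCoxeterSystem.wordProd ω = hK.alt a b ω.length := by
      rw [alt, ← hω']
    -- Appending `a` keeps the alternating word reduced, so its length `ω.length + 1` is at most the
    -- order; this gives the strict inequality that `isAscent_alt` needs.
    have hlen : hK.type a b = 0 ∨ ω.length < hK.type a b := by
      by_contra! hcon
      refine hK.type.toCoxeterSystem.not_isReduced_alternatingWord b a (m := ω.length + 1) ?_ ?_ ?_
      · rw [hK.type.symmetric]; exact hcon.1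
      · rw [hK.type.symmetric]; omega
      · rwa [CoxeterSystem.alternatingWord_succ, ← hω', List.concat_eq_append]
    have hasc := (hK.isAscent_alt hlen).1
    rw [← hv'] at hasc
    -- Lengths add between `hom x` and the parabolic subgroup of `K a ∪ K b`, so ascents of `hom v`
    -- in `K a` are ascents of the product.
    have hxK : ∀ i ∈ K a ∪ K b, ¬ M.toCoxeterSystem.IsRightDescent (hK.hom x) i := by
      rintro i (hi | hi)
      · exact hxasc a (by simp) i hi
      · exact hxasc b (by simp) i hi
    intro i hi
    have hvK := hK.hom_mem_parabolic hv
    have := hasc i hi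
    rw [CoxeterSystem.IsRightDescent] at this ⊢
    rw [map_mul, mul_assoc, CoxeterSystem.length_mul_of_not_isRightDescent hxK hvK,
      CoxeterSystem.length_mul_of_not_isRightDescent hxK
        (mul_mem hvK (CoxeterSystem.simple_mem_parabolic (Or.inl hi)))]
    omega

theorem isRightDescent_hom (hK : M.IsAdmissibleFamily K) {w : hK.type.Group} {a : A}
    (h : hK.type.toCoxeterSystem.IsRightDescent w a) {i : I} (hi : i ∈ K a) :
    M.toCoxeterSystem.IsRightDescent (hK.hom w) i := by
  rw [CoxeterSystem.isRightDescent_iff_not_isRightDescent_mul] at h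
  have := (hK.isAscent_of_not_isRightDescent h).isRightDescent hi
  rwa [CoxeterSystem.simple_mul_simple_cancel_right] at this

theorem hom_injective (hK : M.IsAdmissibleFamily K) : Function.Injective hK.hom := by
  rw [injective_iff_map_eq_one]
  intro w hw
  by_contra h1
  obtain ⟨a, ha⟩ := hK.type.toCoxeterSystem.exists_rightDescent_of_ne_one h1
  obtain ⟨i, hi⟩ := hK.nonempty a
  have := hK.isRightDescent_hom ha hi
  rw [hw] at this
  exact M.toCoxeterSystem.not_isRightDescent_one i this

/-! ### The morphism of Artin-Tits monoids -/

/-- Up to the order of `r_a r_b`, each factor adds its full length, so lifting commutes with the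
product. Equality of the exponent with the order gives the braid relation for the lifts. -/
theorem prod_map_alternatingWord (hK : M.IsAdmissibleFamily K) {a b : A} {k : ℕ}
    (hk : hK.type a b = 0 ∨ k ≤ hK.type a b) :
    ((CoxeterSystem.alternatingWord a b k).map fun c => M.artinLongest (K c)).prod =
      M.simpleLift (hK.hom (hK.alt a b k)) := by
  induction k generalizing a b with
  | zero =>
    rw [alt, CoxeterSystem.alternatingWord, CoxeterSystem.wordProd_nil, map_one, simpleLift_one]
    rfl
  | succ k ih =>
    rw [CoxeterSystem.alternatingWord_succ, List.concat_eq_append, List.map_append,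
      List.prod_append, ih (by rw [hK.type.symmetric]; omega), alt_succ, map_mul, hom_simple,
      simpleLift_mul]
    · simp [artinLongest]
    · have h := (hK.isAscent_alt (a := a) (b := b) (k := k) (by omega)).2.length_hom_mul
      rwa [map_mul, hom_simple] at h

/-- The morphism of Artin-Tits monoids attached to an admissible family. -/
noncomputable def artinHom (hK : M.IsAdmissibleFamily K) : hK.type.ArtinMonoid →* M.ArtinMonoid :=
  PresentedMonoid.lift (fun a => M.artinLongest (K a)) (by
    rintro _ _ ⟨a, b, h⟩
    rw [FreeMonoid.lift_ofList, FreeMonoid.lift_ofList, CoxeterSystem.braidWord,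
      hK.prod_map_alternatingWord (Or.inr le_rfl), CoxeterSystem.braidWord,
      hK.prod_map_alternatingWord (Or.inr le_rfl), alt, alt]
    exact congrArg (fun w => M.simpleLift (hK.hom w))
      (hK.type.toCoxeterSystem.wordProd_braidWord_eq a b))

theorem artinHom_artinGen (hK : M.IsAdmissibleFamily K) (a : A) :
    hK.artinHom (hK.type.artinGen a) = M.artinLongest (K a) := rfl

theorem artinHom_simpleLift (hK : M.IsAdmissibleFamily K) (w : hK.type.Group) :
    hK.artinHom (hK.type.simpleLift w) = M.simpleLift (hK.hom w) := by
  obtain ⟨ω, hω, rfl⟩ := hK.type.toCoxeterSystem.exists_isReduced w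
  rw [simpleLift_wordProd _ hω]
  induction ω using List.reverseRecOn with
  | nil => simp [artinWord, simpleLift_one]
  | append_singleton ω a ih =>
    have h := hω.length_wordProd_append_singleton
    have hasc : hK.IsAscent (hK.type.toCoxeterSystem.wordProd ω) a :=
      hK.isAscent_of_not_isRightDescent (by rw [CoxeterSystem.IsRightDescent]; omega)
    have hl := hasc.length_hom_mul
    rw [map_mul, hom_simple] at hl
    rw [artinWord_append, map_mul, ih hω.of_append_left, CoxeterSystem.wordProd_append,
      CoxeterSystem.wordProd_singleton, map_mul, hom_simple, simpleLift_mul _ hl]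
    simp [artinWord, artinHom_artinGen, artinLongest]

/-- Projecting to the Coxeter group recovers `w` from its lift and sends the generating lifts to the
elements `r_α`. -/
theorem mem_range_of_simpleLift_mem (hK : M.IsAdmissibleFamily K) {w : M.Group}
    (h : M.simpleLift w ∈ Submonoid.closure (Set.range fun a => M.artinLongest (K a))) :
    w ∈ hK.hom.range := by
  have h1 : M.artinToGroup (M.simpleLift w) ∈
      (Submonoid.closure (Set.range fun a => M.artinLongest (K a))).map M.artinToGroup :=
    ⟨_, h, rfl⟩
  rw [artinToGroup_simpleLift] at h1
  have hle : (Submonoid.closure (Set.range fun a => M.artinLongest (K a))).map M.artinToGroup ≤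
      hK.hom.range.toSubmonoid := by
    rw [Submonoid.map_le_iff_le_comap, Submonoid.closure_le]
    rintro _ ⟨a, rfl⟩
    change M.artinToGroup (M.simpleLift (M.longest (K a))) ∈ hK.hom.range
    rw [artinToGroup_simpleLift]
    exact ⟨_, hK.hom_simple a⟩
  exact hle h1

theorem simpleLift_hom_mem (hK : M.IsAdmissibleFamily K) (w : hK.type.Group) :
    M.simpleLift (hK.hom w) ∈ Submonoid.closure (Set.range fun a => M.artinLongest (K a)) := by
  rw [← artinHom_simpleLift, simpleLift, artinWord, map_list_prod, List.map_map]
  refine list_prod_mem fun x hx => ?_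
  obtain ⟨a, -, rfl⟩ := List.mem_map.mp hx
  exact Submonoid.subset_closure ⟨a, rfl⟩

theorem hom_mem_parabolic_iUnion (hK : M.IsAdmissibleFamily K) (w : hK.type.Group) :
    hK.hom w ∈ M.toCoxeterSystem.parabolic (⋃ a, K a) := by
  have hle : hK.hom.range ≤ M.toCoxeterSystem.parabolic (⋃ a, K a) := by
    rw [range_hom, Subgroup.closure_le]
    rintro _ ⟨a, rfl⟩
    exact CoxeterSystem.parabolic_mono (Set.subset_iUnion K a) (hK.spherical a).longest_mem
  exact hle ⟨w, rfl⟩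

theorem isLongest_hom (hK : M.IsAdmissibleFamily K) {r : hK.type.Group}
    (hr : hK.type.IsLongest Set.univ r) : M.IsLongest (⋃ a, K a) (hK.hom r) := by
  rw [isLongest_iff] at hr ⊢
  refine ⟨hK.hom_mem_parabolic_iUnion r, fun i hi => ?_⟩
  obtain ⟨a, ha⟩ := Set.mem_iUnion.mp hi
  exact hK.isRightDescent_hom (hr.2 a (Set.mem_univ a)) ha

/-- A longest element on the side of the type maps to an element having all of `⋃ a, K a` as
descents, which forces finiteness; conversely, `hom` is injective into that parabolic subgroup. -/
theorem isSpherical_univ_iff (hK : M.IsAdmissibleFamily K) :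
    hK.type.IsSpherical Set.univ ↔ M.IsSpherical (⋃ a, K a) := by
  constructor
  · intro h
    exact isSpherical_of_isRightDescent
      (isLongest_iff.mp (hK.isLongest_hom (hK.type.isLongest_longest h))).2
  · intro h
    rw [IsSpherical, parabolic_eq] at h
    have hfin : (hK.hom '' Set.univ).Finite := by
      refine h.subset ?_
      rintro _ ⟨w, -, rfl⟩
      exact hK.hom_mem_parabolic_iUnion w
    exact (hfin.of_finite_image hK.hom_injective.injOn).subset (Set.subset_univ _)

theorem artinHom_artinLongest (hK : M.IsAdmissibleFamily K)
    (h : hK.type.IsSpherical Set.univ) :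
    hK.artinHom (hK.type.artinLongest Set.univ) = M.artinLongest (⋃ a, K a) := by
  rw [artinLongest, artinHom_simpleLift, artinLongest,
    (hK.isLongest_hom (hK.type.isLongest_longest h)).longest_eq]

end IsAdmissibleFamily

/-! ### Admissible partitions of a subset of the vertices -/

theorem image_ambientParts {X : Type*} {J : Set I} (P : Set (Set J)) (f : Set I → X) :
    f '' ambientParts P = Set.range fun α : P => f (Subtype.val '' α.1) := by
  ext x
  simp [ambientParts]

/-- Admissibility is stated in the Coxeter group of `Γ_J`; the isometric embedding `restrictHom`
preserves descents and longest elements, so it passes to `W_Γ`. -/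
theorem IsAdmissible.isAdmissibleFamily {J : Set I} {P : Set (Set J)}
    (hP : (M.restrict J).IsAdmissible P) :
    M.IsAdmissibleFamily fun α : P => Subtype.val '' α.1 where
  nonempty α := by
    refine Set.Nonempty.image _ (Set.nonempty_iff_ne_empty.mpr fun h => ?_)
    exact hP.isPartition.1 (h ▸ α.2)
  disjoint α β hab := by
    rw [Set.disjoint_image_iff Subtype.val_injective]
    exact hP.isPartition.pairwiseDisjoint α.2 β.2 fun h => hab (Subtype.ext h)
  spherical α := M.isSpherical_image J (hP.isSpherical α.1 α.2)
  dichotomy w hw α := by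
    have e : Subgroup.closure (Set.range fun α : P => M.longest (Subtype.val '' α.1)) =
        ((M.restrict J).inducedSubgroup P).map (M.restrictHom J) := by
      rw [inducedSubgroup, MonoidHom.map_closure, Set.image_image, Set.image_eq_range]
      congr 2
      ext α
      exact (M.restrictHom_longest J (hP.isSpherical α.1 α.2)).symm
    rw [e] at hw
    obtain ⟨v, hv, rfl⟩ := hw
    rcases hP.ascents_or_descents v hv α.1 α.2 with h | h
    · left
      rintro _ ⟨i, hi, rfl⟩
      rw [isRightDescent_restrictHom, CoxeterSystem.not_isRightDescent_iff]
      exact h hi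
    · right
      rintro _ ⟨i, hi, rfl⟩
      rw [isRightDescent_restrictHom, CoxeterSystem.isRightDescent_iff]
      exact h hi

end CoxeterMatrix

theorem lemma3p15 {I : Type*} (M : CoxeterMatrix I) (J : Set I) (P : Set (Set J))
    (hP : (M.restrict J).IsAdmissible P) :
    ∃ N : CoxeterMatrix P, (M.restrict J).IsType P N ∧
    ∃ φ : N.ArtinMonoid →* M.ArtinMonoid,
      (∀ α : P, φ (N.artinGen α) = M.artinLongest (Subtype.val '' α.1)) ∧
      φ '' N.simpleElements =
        (M.inducedSubmonoid (CoxeterMatrix.ambientParts P) : Set M.ArtinMonoid) ∩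
          M.simpleElements ∧
      (M.inducedSubmonoid (CoxeterMatrix.ambientParts P) : Set M.ArtinMonoid) ∩
          M.simpleElements =
        M.simpleLift '' (M.inducedSubgroup (CoxeterMatrix.ambientParts P) : Set M.Group) ∧
      (N.IsSpherical Set.univ ↔ M.IsSpherical J) ∧
      (N.IsSpherical Set.univ → φ (N.artinLongest Set.univ) = M.artinLongest J) := by
  have hK := hP.isAdmissibleFamily
  have hU : (⋃ α : P, (Subtype.val '' α.1 : Set I)) = J := by
    rw [← Set.image_iUnion, ← Set.sUnion_eq_iUnion, hP.isPartition.sUnion_eq_univ,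
      Set.image_univ, Subtype.range_coe]
  have hB : M.inducedSubmonoid (CoxeterMatrix.ambientParts P) =
      Submonoid.closure (Set.range fun α : P => M.artinLongest (Subtype.val '' α.1)) := by
    rw [CoxeterMatrix.inducedSubmonoid, CoxeterMatrix.image_ambientParts]
  have hW : M.inducedSubgroup (CoxeterMatrix.ambientParts P) = hK.hom.range := by
    rw [CoxeterMatrix.inducedSubgroup, CoxeterMatrix.image_ambientParts, hK.range_hom]
  have hW' : hK.artinHom '' hK.type.simpleElements =
      M.simpleLift '' (hK.hom.range : Set M.Group) := by
    rw [CoxeterMatrix.simpleElements, ← Set.range_comp, MonoidHom.coe_range, ← Set.range_comp]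
    exact congrArg Set.range (funext hK.artinHom_simpleLift)
  have hB' : (Submonoid.closure (Set.range fun α : P => M.artinLongest (Subtype.val '' α.1)) :
      Set M.ArtinMonoid) ∩ M.simpleElements = M.simpleLift '' (hK.hom.range : Set M.Group) := by
    ext x
    constructor
    · rintro ⟨hx, w, rfl⟩
      exact ⟨w, hK.mem_range_of_simpleLift_mem hx, rfl⟩
    · rintro ⟨_, ⟨w, rfl⟩, rfl⟩
      exact ⟨hK.simpleLift_hom_mem w, _, rfl⟩
  refine ⟨hK.type, fun α β => ?_, hK.artinHom, fun α => hK.artinHom_artinGen α, ?_, ?_, ?_, ?_⟩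
  · rw [hK.type_apply, ← M.restrictHom_longest J (hP.isSpherical α.1 α.2),
      ← M.restrictHom_longest J (hP.isSpherical β.1 β.2), ← map_mul]
    -- `IsType` measures orders in the Coxeter group of `Γ_J`, whereas `hK.type` measures them in
    -- `W_Γ`.
    exact orderOf_injective _ (M.restrictHom_injective J) _
  · rw [hB, hB', hW']
  · rw [hB, hB', hW]
  · rw [hK.isSpherical_univ_iff, hU]
  · intro h
    rw [hK.artinHom_artinLongest h, hU]
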